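/- Let $G_0^a,G_1^a,G_2^a,G_0^b,G_1^b,G_2^b,G_1,G_2>0$ be real numbers, let $\alpha_F,\alpha_R\in(0,1)$, and let $\hat M=\begin{bmatrix}\hat M_{1,1}&\hat M_{1,2}\\ \hat M_{2,1}&\hat M_{2,2}\end{bmatrix}\in\mathbb R^{4\times4}$ with $$\hat M_{1,1}=\begin{bmatrix}\frac{G_0^a+(1-\alpha_F)(G_2^a+G_2)}{\alpha_F}&\frac{\alpha_F(G_1^a+G_1)-(1-\alpha_F)(G_2^a+G_2)}{\alpha_F}\\ \frac{\alpha_RG_0^a-(1-\alpha_R)(G_2^a+G_2)}{\alpha_R}&\frac{G_1^a+G_1+(1-\alpha_R)(G_2^a+G_2)}{\alpha_R}\end{bmatrix},\quad \hat M_{1,2}=\begin{bmatrix}-G_1&\frac{\alpha_FG_1-(1-\alpha_F)G_2}{\alpha_F}\\-\frac{G_1}{\alpha_R}&\frac{G_1+(1-\alpha_R)G_2}{\alpha_R}\end{bmatrix},$$ $$\hat M_{2,1}=\begin{bmatrix}-G_2&\frac{\alpha_FG_2-(1-\alpha_F)G_1}{\alpha_F}\\-\frac{G_2}{\alpha_R}&\frac{G_2+(1-\alpha_R)G_1}{\alpha_R}\end{bmatrix},\quad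 \hat M_{2,2}=\begin{bmatrix}\frac{G_0^b+(1-\alpha_F)(G_2^b+G_1)}{\alpha_F}&\frac{\alpha_F(G_1^b+G_2)-(1-\alpha_F)(G_2^b+G_1)}{\alpha_F}\\ \frac{\alpha_RG_0^b-(1-\alpha_R)(G_2^b+G_1)}{\alpha_R}&\frac{G_1^b+G_2+(1-\alpha_R)(G_2^b+G_1)}{\alpha_R}\end{bmatrix}.$$ Define $$\gamma:=G_0^aG_0^b+(1-\alpha_F)\bigl(G_0^aG_2^b+G_0^bG_2^a+(1-\alpha_F)G_2^aG_2^b\bigr)+(1-\alpha_F)\bigl(G_0^a+(1-\alpha_F)G_2^a\bigr)G_1-\Bigl((2\alpha_F-1)G_1-(1-\alpha_F)\bigl(G_0^b+(1-\alpha_F)G_2^b\bigr)\Bigr)G_2 .$$ For $M\in\mathbb R^{n\times n}$ and $q\in\mathbb R^n$, a solution of $\mathrm{LCP}(M,q)$ is a vector $z\in\mathbb R^n$ with $z\ge0$, $Mz+q\ge0$ componentwise and $(Mz+q)^\top z=0$. For $\alpha\subseteq\{1,\dots,n\}$ let $C_M(\alpha)$ be the $n\times n$ matrix whose $j$-th column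 is $-M_{\cdot,j}$ if $j\in\alpha$ and the $j$-th column of the identity matrix if $j\notin\alpha$, and let $\operatorname{pos}C_M(\alpha)$ be the set of all nonnegative linear combinations of its columns. Let $\mathcal F_M$ be the smallest nonempty family of subsets of $\mathbb R^n$ that contains the cones $\operatorname{pos}C_M(\alpha)$, $\alpha\subseteq\{1,\dots,n\}$, and is closed under complements and finite unions. Write $M\sim N$ if there is a homeomorphism $\varphi:\mathbb R^n\to\mathbb R^n$ such that $P\mapsto\varphi^{-1}(P)$ is a Boolean isomorphism (a bijection respecting intersections and complements) from $\mathcal F_M$ onto $\mathcal F_N$. The matrix $M$ is LCP-stable if it has a neighborhood $U$ in $\mathbb R^{n\times n}$ with $M\sim N$ for all $N\in U$, and LCP-unstable otherwise. Then: 1. If $\gamma>0$, then $\mathrm{LCP}(\hat M,\hat q)$ has exactly one solution for every $\hat q\in\mathbb R^4$. 2. If $\gamma<0$, then $\mathrm{LCP}(\hat M,\hat q)$ has one or three solutions depending on $\hat q$ in the following sense. Let $K=\operatorname{pos}C_{\hat M}(\{1,3\})$. Both the interior of $K$ and the complement $\mathbb R^4\setminus K$ are nonempty; for every $\hat q$ in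 the interior of $K$ the problem has exactly three solutions, and for every $\hat q\notin K$ it has exactly one solution. (Nothing is asserted for $\hat q$ on the boundary of $K$.) 3. If $\gamma=0$, then $\hat M$ is LCP-unstable. -/

import Mathlib

/-- `z` solves the linear complementarity problem `LCP(M, q)`:
`M z + q ≥ 0`, `z ≥ 0` (componentwise) and `M z + q ⟂ z`. -/
def IsLCPSolution {n : ℕ} (M : Matrix (Fin n) (Fin n) ℝ) (q z : Fin n → ℝ) : Prop :=
  (∀ i, 0 ≤ (M.mulVec z + q) i) ∧ (∀ i, 0 ≤ z i) ∧ (M.mulVec z + q) ⬝ᵥ z = 0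

/-- `pos A`: the polyhedral cone of all nonnegative combinations of the columns of `A`. -/
def posCone {n m : ℕ} (A : Matrix (Fin n) (Fin m) ℝ) : Set (Fin n → ℝ) :=
  {x | ∃ p : Fin m → ℝ, (∀ j, 0 ≤ p j) ∧ x = ∑ j, p j • (fun i => A i j)}

/-- The complementary matrix `C_M(α)`: column `j` is `-M_{·,j}` if `j ∈ α`, and the `j`-th column
of the identity otherwise. -/
def complementaryMatrix {n : ℕ} (M : Matrix (Fin n) (Fin n) ℝ) (α : Finset (Fin n)) :
    Matrix (Fin n) (Fin n) ℝ :=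
  Matrix.of fun i j => if j ∈ α then -M i j else (1 : Matrix (Fin n) (Fin n) ℝ) i j

/-- The complementary cone `pos C_M(α)`. -/
def complementaryCone {n : ℕ} (M : Matrix (Fin n) (Fin n) ℝ) (α : Finset (Fin n)) :
    Set (Fin n → ℝ) :=
  posCone (complementaryMatrix M α)

/-- The field of sets generated by the complementary cones of `M`: the smallest nonempty family of
subsets of `ℝⁿ` that contains all complementary cones and is closed under complements and finite
unions. -/
def lcpField {n : ℕ} (M : Matrix (Fin n) (Fin n) ℝ) : Set (Set (Fin n → ℝ)) :=
  MeasureTheory.generateSetAlgebra (Set.range (complementaryCone M))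

/-- `h` restricts to a Boolean isomorphism from the field of sets `F` (on `X`) to the field of sets
`F'` (on `Y`): a bijection that respects intersections and complements. -/
structure IsBooleanIso {X Y : Type*} (F : Set (Set X)) (F' : Set (Set Y))
    (h : Set X → Set Y) : Prop where
  bijOn : Set.BijOn h F F'
  map_inter : ∀ P ∈ F, ∀ Q ∈ F, h (P ∩ Q) = h P ∩ h Q
  map_compl : ∀ P ∈ F, h Pᶜ = (h P)ᶜ

/-- `M ∼ N`: some homeomorphism `φ` of `ℝⁿ` induces, through `P ↦ φ⁻¹(P)`, a Boolean isomorphism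
from the field of sets of `M` to the field of sets of `N`. -/
def LCPEquivalent {n : ℕ} (M N : Matrix (Fin n) (Fin n) ℝ) : Prop :=
  ∃ φ : (Fin n → ℝ) ≃ₜ (Fin n → ℝ),
    IsBooleanIso (lcpField M) (lcpField N) (fun P => φ ⁻¹' P)

/-- `M` is LCP-stable if it is LCP-equivalent to every matrix in some neighborhood of it. -/
def LCPStable {n : ℕ} (M : Matrix (Fin n) (Fin n) ℝ) : Prop :=
  ∃ U ∈ nhds M, ∀ N ∈ U, LCPEquivalent M N

/-- The circuit matrix `M̂`, with conductances `G₀ᵃ, G₁ᵃ, G₂ᵃ, G₀ᵇ, G₁ᵇ, G₂ᵇ, G₁, G₂` and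
transistor gains `α_F, α_R`. -/
noncomputable def circuitMatrix (G0a G1a G2a G0b G1b G2b G1 G2 αF αR : ℝ) :
    Matrix (Fin 4) (Fin 4) ℝ :=
  !![(G0a + (1 - αF) * (G2a + G2)) / αF, (αF * (G1a + G1) - (1 - αF) * (G2a + G2)) / αF,
      -G1, (αF * G1 - (1 - αF) * G2) / αF;
    (αR * G0a - (1 - αR) * (G2a + G2)) / αR, (G1a + G1 + (1 - αR) * (G2a + G2)) / αR,
      -G1 / αR, (G1 + (1 - αR) * G2) / αR;
    -G2, (αF * G2 - (1 - αF) * G1) / αF,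
      (G0b + (1 - αF) * (G2b + G1)) / αF, (αF * (G1b + G2) - (1 - αF) * (G2b + G1)) / αF;
    -G2 / αR, (G2 + (1 - αR) * G1) / αR,
      (αR * G0b - (1 - αR) * (G2b + G1)) / αR, (G1b + G2 + (1 - αR) * (G2b + G1)) / αR]

/-- The quantity `γ` that decides the number of solutions. -/
def circuitGamma (G0a G2a G0b G2b G1 G2 αF : ℝ) : ℝ :=
  G0a * G0b + (1 - αF) * (G0a * G2b + G0b * G2a + (1 - αF) * G2a * G2b)
    + (1 - αF) * (G0a + (1 - αF) * G2a) * G1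
    - ((2 * αF - 1) * G1 - (1 - αF) * (G0b + (1 - αF) * G2b)) * G2

/-! Of the sixteen principal minors of the circuit matrix, fifteen are positive for all admissible
parameters, and the one on `{0, 2}` is `γ / αF ^ 2`. The sign of this single minor decides
everything.

The tool is `exists_slice`: freeze one variable at the value `t`. If the problem in the other
variables is uniquely solvable, the residual in the frozen row is a continuous piecewise affine
function `h t`, and the solutions of the full problem correspond to those of `0 ≤ t ⟂ h t ≥ 0`. On
the piece where `β` is a feasible basis, the slope of `h` is the quotient of the minors on `insert a
β` and `β`. If all minors are positive, `h` increases strictly and the solution is unique; induction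
on the index set gives `existsUnique_partialLCP`, hence the case `γ > 0`.

For `γ ≤ 0` freeze variable `0`. Only the piece of `β₀ = {2}` can have nonpositive slope, and its
part in `t ≥ 0` is a bounded interval, so `h` rises before and after it. A zero of `h` on that
interval puts `q` in the cone of `{0, 2}`. Outside the cone there is therefore one solution; in its
interior, with `γ < 0`, the function rises, falls through zero and rises again, which gives three.

For `γ = 0` the cone of `{0, 2}` is degenerate and a generic `q` lies in exactly one of the other
fifteen, so the field of sets cannot contain sixteen pairwise disjoint members with nonempty
interior. A small increase of `G0a` makes `γ` positive, and then it can. A homeomorphism preserves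
this property (`not_lcpEquivalent`). -/

section LinearComplementarity

open Set

/-! ### Scalar complementarity for piecewise monotone functions -/

theorem lt_of_Ioo_subset_biUnion {ι : Type*} [DecidableEq ι] {h : ℝ → ℝ} {T : ι → Set ℝ}
    (hT : ∀ b, IsClosed (T b)) (s : Finset ι) :
    (∀ b ∈ s, StrictMonoOn h (T b)) → ∀ {x y : ℝ}, x < y →
      (∀ t ∈ Ioo x y, ∃ b ∈ s, t ∈ T b) → h x < h y := by
  induction s using Finset.strongInduction with
  | H s ih =>
    intro hm x y hxy hcov
    have hcl : IsClosed (⋃ b ∈ s, T b) := s.finite_toSet.isClosed_biUnion fun b _ => hT b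
    have hIcc : Icc x y ⊆ ⋃ b ∈ s, T b := by
      rw [← closure_Ioo hxy.ne]
      refine hcl.closure_subset_iff.2 fun t ht => ?_
      simpa using hcov t ht
    obtain ⟨b, hb, hxb⟩ : ∃ b ∈ s, x ∈ T b := by simpa using hIcc (left_mem_Icc.2 hxy.le)
    -- From `x`, jump to the last point `c` of `T b` in `[x, y]`. Beyond `c` the set `T b` is no
    -- longer needed, so the induction goes on with one set fewer.
    have hcomp : IsCompact (T b ∩ Icc x y) := isCompact_Icc.inter_left (hT b)
    obtain ⟨c, ⟨hcb, hxc, hcy⟩, hmax⟩ :=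
      hcomp.exists_isGreatest ⟨x, hxb, left_mem_Icc.2 hxy.le⟩
    have hxc' : h x ≤ h c := (hm b hb).monotoneOn hxb hcb hxc
    rcases hcy.eq_or_lt with rfl | hcy
    · exact hm b hb hxb hcb hxy
    · refine hxc'.trans_lt (ih (s.erase b) (Finset.erase_ssubset hb)
        (fun d hd => hm d (Finset.mem_of_mem_erase hd)) hcy fun t ht => ?_)
      obtain ⟨d, hd, htd⟩ : ∃ d ∈ s, t ∈ T d := by
        simpa using hIcc ⟨hxc.trans ht.1.le, ht.2.le⟩
      refine ⟨d, Finset.mem_erase.2 ⟨?_, hd⟩, htd⟩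
      rintro rfl
      exact absurd (hmax ⟨htd, hxc.trans ht.1.le, ht.2.le⟩) (not_le.2 ht.1)

/-- The scalar complementarity condition `0 ≤ t ⟂ h t ≥ 0`. -/
def scalarSolutions (h : ℝ → ℝ) : Set ℝ := {t | 0 ≤ t ∧ 0 ≤ h t ∧ t * h t = 0}

theorem scalarSolutions_eq_zero {h : ℝ → ℝ} {t : ℝ} (ht : t ∈ scalarSolutions h) (h0 : 0 < t) :
    h t = 0 := (mul_eq_zero.1 ht.2.2).resolve_left h0.ne'

theorem exists_scalarSolution_le {h : ℝ → ℝ} (hc : ContinuousOn h (Ici 0)) {u : ℝ}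
    (hu : 0 ≤ u) (hpos : 0 < h u) : ∃ t ∈ scalarSolutions h, t ≤ u := by
  rcases le_or_gt 0 (h 0) with h0 | h0
  · exact ⟨0, ⟨le_rfl, h0, zero_mul _⟩, hu⟩
  · obtain ⟨t, ht, hht⟩ := intermediate_value_Icc hu (hc.mono Icc_subset_Ici_self)
      (show (0 : ℝ) ∈ Icc (h 0) (h u) from ⟨h0.le, hpos.le⟩)
    exact ⟨t, ⟨ht.1, hht.ge, by rw [hht, mul_zero]⟩, ht.2⟩

theorem exists_zero_gt {h : ℝ → ℝ} (hc : ContinuousOn h (Ici 0)) {s u : ℝ} (hs : 0 ≤ s)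
    (hsu : s < u) (hneg : h s < 0) (hpos : 0 < h u) :
    ∃ t ∈ scalarSolutions h, s < t := by
  obtain ⟨t, ht, hht⟩ := intermediate_value_Icc hsu.le
    (hc.mono fun x hx => hs.trans hx.1) (show (0 : ℝ) ∈ Icc (h s) (h u) from ⟨hneg.le, hpos.le⟩)
  refine ⟨t, ⟨hs.trans ht.1, hht.ge, by rw [hht, mul_zero]⟩, ht.1.lt_of_ne ?_⟩
  rintro rfl
  linarith

theorem scalarSolutions_eq_of_strictMonoOn {h : ℝ → ℝ} {I : Set ℝ} (hI : StrictMonoOn h I)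
    {t t' : ℝ} (ht : t ∈ scalarSolutions h) (ht' : t' ∈ scalarSolutions h) (htI : t ∈ I)
    (htI' : t' ∈ I) : t = t' := by
  wlog hlt : t < t' generalizing t t'
  · rcases (not_lt.1 hlt).eq_or_lt with h1 | h1
    · exact h1.symm
    · exact (this ht' ht htI' htI h1).symm
  have h1 := hI htI htI' hlt
  have h2 := scalarSolutions_eq_zero ht' (ht.1.trans_lt hlt)
  linarith [ht.2.1]

theorem existsUnique_scalarSolution {h : ℝ → ℝ} (hc : ContinuousOn h (Ici 0))
    (hm : StrictMonoOn h (Ici 0)) {u : ℝ} (hu : 0 ≤ u) (hpos : 0 < h u) :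
    ∃! t, t ∈ scalarSolutions h := by
  obtain ⟨t, ht, -⟩ := exists_scalarSolution_le hc hu hpos
  exact ⟨t, ht, fun t' ht' => scalarSolutions_eq_of_strictMonoOn hm ht' ht ht'.1 ht.1⟩

/-- By connectedness `h` has constant sign on `[a, b]`, whatever its shape there. If positive, it
stays positive to the right and the solution lies in `[0, a]`; if negative, every solution lies
beyond `b`. -/
theorem existsUnique_scalarSolution_of_ne_zero_on_Icc {h : ℝ → ℝ} (hc : ContinuousOn h (Ici 0))
    {a b : ℝ} (ha : 0 ≤ a) (hab : a ≤ b) (hma : StrictMonoOn h (Icc 0 a))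
    (hmb : StrictMonoOn h (Ici b)) (hne : ∀ t ∈ Icc a b, h t ≠ 0) {u : ℝ} (hbu : b < u)
    (hpos : 0 < h u) : ∃! t, t ∈ scalarSolutions h := by
  have hcab : ∀ x y, x ∈ Icc a b → y ∈ Icc a b → 0 < h x → 0 < h y := by
    intro x y hx hy h0
    by_contra hle
    obtain ⟨t, ht, hht⟩ := isPreconnected_Icc.intermediate_value hy hx
      (hc.mono fun t ht => ha.trans ht.1)
      (show (0 : ℝ) ∈ Icc (h y) (h x) from ⟨not_lt.1 hle, h0.le⟩)
    exact hne t ht hht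
  rcases lt_or_ge 0 (h a) with h0 | h0
  · obtain ⟨t, ht, hta⟩ := exists_scalarSolution_le hc ha h0
    have key : ∀ t' ∈ scalarSolutions h, t' ≤ a := by
      intro t' ht'
      by_contra hlt
      have hlt := not_le.1 hlt
      have hz := scalarSolutions_eq_zero ht' (ha.trans_lt hlt)
      rcases le_or_gt t' b with h1 | h1
      · exact hne t' ⟨hlt.le, h1⟩ hz
      · have h2 := hmb self_mem_Ici h1.le h1
        have h3 := hcab a b (left_mem_Icc.2 hab) (right_mem_Icc.2 hab) h0
        linarith
    exact ⟨t, ht, fun t' ht' => scalarSolutions_eq_of_strictMonoOn hma ht' ht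
      ⟨ht'.1, key t' ht'⟩ ⟨ht.1, hta⟩⟩
  · have hneg : ∀ x ∈ Icc a b, h x < 0 := fun x hx => by
      by_contra hle
      have h1 := hcab x a hx (left_mem_Icc.2 hab) ((not_lt.1 hle).lt_of_ne (hne x hx).symm)
      linarith
    obtain ⟨t, ht, htb⟩ := exists_zero_gt hc (ha.trans hab) hbu
      (hneg b (right_mem_Icc.2 hab)) hpos
    have key : ∀ t' ∈ scalarSolutions h, b ≤ t' := by
      intro t' ht'
      by_contra hlt
      have hlt := not_le.1 hlt
      rcases le_or_gt a t' with h1 | h1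
      · linarith [hneg t' ⟨h1, hlt.le⟩, ht'.2.1]
      · have h2 := hma ⟨ht'.1, h1.le⟩ ⟨ha, le_rfl⟩ h1
        linarith [ht'.2.1]
    exact ⟨t, ht, fun t' ht' => scalarSolutions_eq_of_strictMonoOn hmb ht' ht
      (key t' ht') htb.le⟩

/-- Here `h a > 0 > h b`, so each of the three monotone stretches contributes exactly one solution;
the first may be `t = 0` with `h 0 > 0`. -/
theorem ncard_scalarSolutions_eq_three {h : ℝ → ℝ} (hc : ContinuousOn h (Ici 0))
    {a b c : ℝ} (ha : 0 ≤ a) (hac : a < c) (hcb : c < b) (hma : StrictMonoOn h (Icc 0 a))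
    (hmb : StrictMonoOn h (Ici b)) (hab : StrictAntiOn h (Icc a b)) (hz : h c = 0) {u : ℝ}
    (hbu : b < u) (hpos : 0 < h u) : (scalarSolutions h).ncard = 3 := by
  have h_a : 0 < h a := hz ▸ hab ⟨le_rfl, (hac.trans hcb).le⟩ ⟨hac.le, hcb.le⟩ hac
  have h_b : h b < 0 := hz ▸ hab ⟨hac.le, hcb.le⟩ ⟨(hac.trans hcb).le, le_rfl⟩ hcb
  obtain ⟨t, ht, hta⟩ := exists_scalarSolution_le hc ha h_a
  obtain ⟨t', ht', htb⟩ := exists_zero_gt hc (ha.trans (hac.trans hcb).le) hbu h_b hpos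
  have hset : scalarSolutions h = {t, c, t'} := by
    ext x
    simp only [mem_insert_iff, mem_singleton_iff]
    constructor
    · intro hx
      rcases le_or_gt x a with h1 | h1
      · exact Or.inl (scalarSolutions_eq_of_strictMonoOn hma hx ht ⟨hx.1, h1⟩ ⟨ht.1, hta⟩)
      rcases le_or_gt x b with h2 | h2
      · refine Or.inr (Or.inl (hab.injOn ⟨h1.le, h2⟩ ⟨hac.le, hcb.le⟩ ?_))
        rw [hz, scalarSolutions_eq_zero hx (ha.trans_lt h1)]
      · exact Or.inr (Or.inr (scalarSolutions_eq_of_strictMonoOn hmb hx ht' h2.le htb.le))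
    · rintro (rfl | rfl | rfl)
      · exact ht
      · exact ⟨(ha.trans_lt hac).le, hz.ge, by rw [hz, mul_zero]⟩
      · exact ht'
  rw [hset]
  exact ncard_eq_three.2 ⟨t, c, t', (hta.trans_lt hac).ne, (hta.trans_lt (hac.trans
    (hcb.trans htb))).ne, (hcb.trans htb).ne, rfl⟩

/-! ### Principal pivots, freezing one variable, and matrices with positive principal minors -/

section
variable {n : ℕ}

/-- Column `j` is `M_{·,j}` if `j ∈ β`, and the `j`-th column of the identity otherwise; the
determinant is the principal minor of `M` on `β`. -/
def principalColumns (M : Matrix (Fin n) (Fin n) ℝ) (β : Finset (Fin n)) :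
    Matrix (Fin n) (Fin n) ℝ :=
  Matrix.of fun i j => if j ∈ β then M i j else (1 : Matrix (Fin n) (Fin n) ℝ) i j

theorem principalColumns_mulVec (M : Matrix (Fin n) (Fin n) ℝ) (β : Finset (Fin n))
    (y : Fin n → ℝ) (i : Fin n) :
    (principalColumns M β).mulVec y i =
      M.mulVec (fun j => if j ∈ β then y j else 0) i + if i ∈ β then 0 else y i := by
  have h1 : (if i ∈ β then 0 else y i) =
      ∑ j, (1 : Matrix (Fin n) (Fin n) ℝ) i j * if j ∈ β then 0 else y j :=
    (congrFun (Matrix.one_mulVec fun j => if j ∈ β then 0 else y j) i).symm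
  rw [h1]
  simp only [Matrix.mulVec, dotProduct, ← Finset.sum_add_distrib]
  refine Finset.sum_congr rfl fun j _ => ?_
  by_cases hj : j ∈ β <;> simp [principalColumns, hj]

theorem complementaryMatrix_mulVec (M : Matrix (Fin n) (Fin n) ℝ) (β : Finset (Fin n))
    (y : Fin n → ℝ) (i : Fin n) :
    (complementaryMatrix M β).mulVec y i =
      -M.mulVec (fun j => if j ∈ β then y j else 0) i + if i ∈ β then 0 else y i := by
  have h1 : (if i ∈ β then 0 else y i) =
      ∑ j, (1 : Matrix (Fin n) (Fin n) ℝ) i j * if j ∈ β then 0 else y j :=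
    (congrFun (Matrix.one_mulVec fun j => if j ∈ β then 0 else y j) i).symm
  rw [h1]
  simp only [Matrix.mulVec, dotProduct, ← Finset.sum_add_distrib, ← Finset.sum_neg_distrib]
  refine Finset.sum_congr rfl fun j _ => ?_
  by_cases hj : j ∈ β <;> simp [complementaryMatrix, hj]

/-- The linear complementarity problem on the index set `A`, all other variables being zero. -/
def PartialLCP (M : Matrix (Fin n) (Fin n) ℝ) (q : Fin n → ℝ) (A : Finset (Fin n))
    (z : Fin n → ℝ) : Prop :=
  (∀ i, i ∉ A → z i = 0) ∧
    ∀ i ∈ A, 0 ≤ z i ∧ 0 ≤ (M.mulVec z + q) i ∧ z i * (M.mulVec z + q) i = 0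

theorem isLCPSolution_iff_partialLCP (M : Matrix (Fin n) (Fin n) ℝ) (q z : Fin n → ℝ) :
    IsLCPSolution M q z ↔ PartialLCP M q Finset.univ z := by
  constructor
  · rintro ⟨hw, hz, h0⟩
    refine ⟨fun i hi => absurd (Finset.mem_univ i) hi, fun i hi => ⟨hz i, hw i, ?_⟩⟩
    rw [mul_comm]
    exact (Finset.sum_eq_zero_iff_of_nonneg fun j _ => mul_nonneg (hw j) (hz j)).1 h0 i hi
  · rintro ⟨-, h⟩
    refine ⟨fun i => (h i (Finset.mem_univ i)).2.1, fun i => (h i (Finset.mem_univ i)).1, ?_⟩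
    exact Finset.sum_eq_zero fun i hi => by rw [mul_comm]; exact (h i hi).2.2

/-- Principal pivoting: solving `principalColumns M β` for `v` yields minus the variables on `β` and
the residuals off `β` in a single vector. This explains the opposite signs required in `basicSet`.
-/
theorem mulVec_basic_add {M : Matrix (Fin n) (Fin n) ℝ} {β : Finset (Fin n)}
    (hβ : (principalColumns M β).det ≠ 0) (v : Fin n → ℝ) (i : Fin n) :
    (M.mulVec (fun j => if j ∈ β then -((principalColumns M β)⁻¹.mulVec v) j else 0) + v) i =
      if i ∈ β then 0 else ((principalColumns M β)⁻¹.mulVec v) i := by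
  have hu : IsUnit (principalColumns M β).det := isUnit_iff_ne_zero.2 hβ
  have h1 := principalColumns_mulVec M β ((principalColumns M β)⁻¹.mulVec v) i
  rw [Matrix.mulVec_mulVec, Matrix.mul_nonsing_inv _ hu, Matrix.one_mulVec] at h1
  have h2 : (fun j => if j ∈ β then -((principalColumns M β)⁻¹.mulVec v) j else 0) =
      -(fun j => if j ∈ β then ((principalColumns M β)⁻¹.mulVec v) j else 0) := by
    ext j; by_cases hj : j ∈ β <;> simp [hj]
  rw [h2, Matrix.mulVec_neg, Pi.add_apply, Pi.neg_apply, h1]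
  ring

theorem inv_mulVec_eq_of_complementary {M : Matrix (Fin n) (Fin n) ℝ} {β : Finset (Fin n)}
    (hβ : (principalColumns M β).det ≠ 0) {v z : Fin n → ℝ} (hz : ∀ i, i ∉ β → z i = 0)
    (hw : ∀ i ∈ β, (M.mulVec z + v) i = 0) :
    (principalColumns M β)⁻¹.mulVec v =
      fun i => if i ∈ β then -z i else (M.mulVec z + v) i := by
  have hu : IsUnit (principalColumns M β).det := isUnit_iff_ne_zero.2 hβ
  suffices h : (principalColumns M β).mulVec
      (fun i => if i ∈ β then -z i else (M.mulVec z + v) i) = v by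
    conv_lhs => rw [← h]
    rw [Matrix.mulVec_mulVec, Matrix.nonsing_inv_mul _ hu, Matrix.one_mulVec]
  ext i
  rw [principalColumns_mulVec]
  have h2 : (fun j => if j ∈ β then (if j ∈ β then -z j else (M.mulVec z + v) j) else 0) = -z := by
    ext j; by_cases hj : j ∈ β <;> simp [hj, hz]
  rw [h2, Matrix.mulVec_neg, Pi.neg_apply]
  by_cases hi : i ∈ β
  · have := hw i hi
    simp only [Pi.add_apply] at this
    simp only [hi, if_true]
    linarith
  · simp [hi]

/-- The basic vector of the index set `β` for the right-hand side `q + t M_{·,a}`. -/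
noncomputable def basicVec (M : Matrix (Fin n) (Fin n) ℝ) (q : Fin n → ℝ) (a : Fin n)
    (β : Finset (Fin n)) (t : ℝ) : Fin n → ℝ :=
  (principalColumns M β)⁻¹.mulVec (q + t • fun i => M i a)

/-- The parameters `t` for which `β` is a feasible basis on the index set `A`. -/
def basicSet (M : Matrix (Fin n) (Fin n) ℝ) (q : Fin n → ℝ) (A : Finset (Fin n)) (a : Fin n)
    (β : Finset (Fin n)) : Set ℝ :=
  {t | (∀ i ∈ β, basicVec M q a β t i ≤ 0) ∧ ∀ i ∈ A, i ∉ β → 0 ≤ basicVec M q a β t i}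

theorem basicVec_apply (M : Matrix (Fin n) (Fin n) ℝ) (q : Fin n → ℝ) (a : Fin n)
    (β : Finset (Fin n)) (t : ℝ) (i : Fin n) :
    basicVec M q a β t i = (principalColumns M β)⁻¹.mulVec q i +
      t * (principalColumns M β)⁻¹.mulVec (fun i => M i a) i := by
  simp [basicVec, Matrix.mulVec_add, Matrix.mulVec_smul]

theorem continuous_basicVec_apply (M : Matrix (Fin n) (Fin n) ℝ) (q : Fin n → ℝ) (a : Fin n)
    (β : Finset (Fin n)) (i : Fin n) : Continuous fun t => basicVec M q a β t i := by
  simp only [basicVec_apply]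
  fun_prop

theorem isClosed_basicSet (M : Matrix (Fin n) (Fin n) ℝ) (q : Fin n → ℝ) (A : Finset (Fin n))
    (a : Fin n) (β : Finset (Fin n)) : IsClosed (basicSet M q A a β) := by
  simp only [basicSet, ofPred_and, ofPred_forall]
  exact (isClosed_iInter fun i => isClosed_iInter fun _ =>
    isClosed_le (continuous_basicVec_apply M q a β i) continuous_const).inter
    (isClosed_iInter fun i => isClosed_iInter fun _ => isClosed_iInter fun _ =>
      isClosed_le continuous_const (continuous_basicVec_apply M q a β i))

theorem ordConnected_basicSet (M : Matrix (Fin n) (Fin n) ℝ) (q : Fin n → ℝ)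
    (A : Finset (Fin n)) (a : Fin n) (β : Finset (Fin n)) :
    (basicSet M q A a β).OrdConnected := by
  refine ⟨fun x hx y hy t ht => ⟨fun i hi => ?_, fun i hi hiβ => ?_⟩⟩
  · have h1 := hx.1 i hi
    have h2 := hy.1 i hi
    rw [basicVec_apply] at h1 h2 ⊢
    rcases le_total 0 ((principalColumns M β)⁻¹.mulVec (fun i => M i a) i) with h | h
    · nlinarith [mul_le_mul_of_nonneg_right ht.2 h]
    · nlinarith [mul_le_mul_of_nonpos_right ht.1 h]
  · have h1 := hx.2 i hi hiβ
    have h2 := hy.2 i hi hiβ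
    rw [basicVec_apply] at h1 h2 ⊢
    rcases le_total 0 ((principalColumns M β)⁻¹.mulVec (fun i => M i a) i) with h | h
    · nlinarith [mul_le_mul_of_nonneg_right ht.1 h]
    · nlinarith [mul_le_mul_of_nonpos_right ht.2 h]

/-- Cramer's rule. It makes the slope in `t` of coordinate `a` of `basicVec` a quotient of two
principal minors. -/
theorem det_mul_inv_mulVec_col (M : Matrix (Fin n) (Fin n) ℝ) {a : Fin n} {β : Finset (Fin n)}
    (hβ : (principalColumns M β).det ≠ 0) :
    (principalColumns M β).det * (principalColumns M β)⁻¹.mulVec (fun i => M i a) a =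
      (principalColumns M (insert a β)).det := by
  have h1 : principalColumns M (insert a β) =
      (principalColumns M β).updateCol a (fun i => M i a) := by
    ext i j
    by_cases hj : j = a
    · subst hj; simp [principalColumns]
    · simp [principalColumns, hj]
  rw [h1, ← Matrix.cramer_apply, Matrix.cramer_eq_adjugate_mulVec, Matrix.inv_def,
    Matrix.smul_mulVec, Ring.inverse_eq_inv', Pi.smul_apply, smul_eq_mul,
    mul_inv_cancel_left₀ hβ]

/-- Solutions on `insert a A` are parametrised by the scalar complementarity problem of a
piecewise affine function. -/
theorem exists_slice {M : Matrix (Fin n) (Fin n) ℝ} {A : Finset (Fin n)} {a : Fin n}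
    (ha : a ∉ A) (hdet : ∀ β ⊆ A, (principalColumns M β).det ≠ 0)
    (huniq : ∀ q, ∃! z, PartialLCP M q A z) (q : Fin n → ℝ) :
    ∃ (h : ℝ → ℝ) (S : ℝ → Fin n → ℝ), Function.Injective S ∧
      {z | PartialLCP M q (insert a A) z} = S '' scalarSolutions h ∧
      (∀ β ⊆ A, ∀ t ∈ basicSet M q A a β, h t = basicVec M q a β t a) ∧
      ∀ t, ∃ β ⊆ A, t ∈ basicSet M q A a β := by
  -- `Z t` is the unique solution on `A` when variable `a` is fixed at `t`; `h t` will be the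
  -- residual it leaves in row `a`.
  choose Z hZ hZu using fun t : ℝ => huniq (q + t • fun i => M i a)
  have hcol : ∀ t : ℝ, M.mulVec (t • Pi.single a 1) = t • fun i => M i a := fun t => by
    rw [Matrix.mulVec_smul, Matrix.mulVec_single_one]; rfl
  have hres : ∀ t, M.mulVec (Z t + t • Pi.single a 1) + q =
      M.mulVec (Z t) + (q + t • fun i => M i a) := fun t => by
    rw [Matrix.mulVec_add, hcol]; abel
  have hSa : ∀ t, (Z t + t • Pi.single a (1 : ℝ) : Fin n → ℝ) a = t := fun t => by
    simp [(hZ t).1 a ha]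
  have hSi : ∀ t i, i ≠ a → (Z t + t • Pi.single a (1 : ℝ) : Fin n → ℝ) i = Z t i :=
    fun t i hi => by simp [hi]
  refine ⟨fun t => (M.mulVec (Z t) + (q + t • fun i => M i a)) a,
    fun t => Z t + t • Pi.single a 1, fun t t' htt => ?_, ?_, ?_, ?_⟩
  · have := congrFun htt a
    simpa only [hSa] using this
  · ext z
    constructor
    · rintro ⟨hz0, hz⟩
      have hsplit : z = (z - z a • Pi.single a 1) + z a • Pi.single a 1 := by abel
      have hZz : z - z a • Pi.single a 1 = Z (z a) := by
        refine hZu (z a) _ ⟨fun i hi => ?_, fun i hi => ?_⟩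
        · by_cases hia : i = a
          · subst hia; simp
          · simp [hia, hz0 i (by simp [hia, hi])]
        · have hia : i ≠ a := fun h => ha (h ▸ hi)
          have h1 : M.mulVec (z - z a • Pi.single a 1) + (q + z a • fun i => M i a) =
              M.mulVec z + q := by
            rw [Matrix.mulVec_sub, hcol]; abel
          rw [h1]
          simpa [hia] using hz i (Finset.mem_insert_of_mem hi)
      have hzS : Z (z a) + z a • Pi.single a 1 = z := by rw [← hZz]; abel
      refine ⟨z a, ?_, hzS⟩
      have h2 := hz a (Finset.mem_insert_self a A)
      rw [← hzS, hres, hSa] at h2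
      exact h2
    · rintro ⟨t, ht, rfl⟩
      beta_reduce
      refine ⟨fun i hi => ?_, fun i hi => ?_⟩
      · rw [Finset.mem_insert, not_or] at hi
        rw [hSi t i hi.1, (hZ t).1 i hi.2]
      · rw [hres]
        rcases Finset.mem_insert.1 hi with rfl | hiA
        · rw [hSa]; exact ht
        · rw [hSi t i fun h => ha (h ▸ hiA)]
          exact (hZ t).2 i hiA
  · intro β hβ t ht
    have hb := mulVec_basic_add (hdet β hβ) (q + t • fun i => M i a)
    -- Feasibility of `β` at `t` makes its basic vector a solution on `A`, which by uniqueness is `Z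
    -- t`.
    have hZt : (fun j => if j ∈ β then -((principalColumns M β)⁻¹.mulVec
        (q + t • fun i => M i a)) j else 0) = Z t := by
      refine hZu t _ ⟨fun i hi => if_neg fun h => hi (hβ h), fun i hi => ?_⟩
      rw [hb]
      by_cases hiβ : i ∈ β
      · simpa [hiβ, basicVec] using ht.1 i hiβ
      · simpa [hiβ, basicVec] using ht.2 i hi hiβ
    have h1 := hb a
    rw [hZt, if_neg fun h => ha (hβ h)] at h1
    exact h1
  · intro t
    -- The rows of `A` with vanishing residual form a feasible basis; a variable outside them is
    -- zero by complementarity.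
    refine ⟨{i ∈ A | (M.mulVec (Z t) + (q + t • fun i => M i a)) i = 0},
      Finset.filter_subset _ _, ?_⟩
    have hx := inv_mulVec_eq_of_complementary
      (hdet {i ∈ A | (M.mulVec (Z t) + (q + t • fun i => M i a)) i = 0} (Finset.filter_subset _ _))
      (v := q + t • fun i => M i a) (z := Z t) (fun i hi => ?_)
      (fun i hi => (Finset.mem_filter.1 hi).2)
    · refine ⟨fun i hi => ?_, fun i hi hiβ => ?_⟩
      · rw [basicVec, hx]
        simp only [hi, if_true]
        linarith [((hZ t).2 i (Finset.mem_filter.1 hi).1).1]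
      · rw [basicVec, hx]
        simp only [hiβ, if_false]
        exact ((hZ t).2 i hi).2.1
    · by_cases hiA : i ∈ A
      · have := ((hZ t).2 i hiA).2.2
        rw [Finset.mem_filter, not_and] at hi
        exact (mul_eq_zero.1 this).resolve_right (hi hiA)
      · exact (hZ t).1 i hiA

theorem continuousOn_of_basicSet {M : Matrix (Fin n) (Fin n) ℝ} {q : Fin n → ℝ}
    {A : Finset (Fin n)} {a : Fin n} {h : ℝ → ℝ}
    (hh : ∀ β ⊆ A, ∀ t ∈ basicSet M q A a β, h t = basicVec M q a β t a)
    (hcov : ∀ t, ∃ β ⊆ A, t ∈ basicSet M q A a β) : Continuous h := by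
  have h1 : (⋃ β : A.powerset, basicSet M q A a β) = univ := by
    refine eq_univ_of_forall fun t => ?_
    obtain ⟨β, hβ, ht⟩ := hcov t
    exact mem_iUnion.2 ⟨⟨β, Finset.mem_powerset.2 hβ⟩, ht⟩
  refine (locallyFinite_of_finite fun β : A.powerset => basicSet M q A a β).continuous h1
    (fun β => isClosed_basicSet M q A a β) fun β => ?_
  exact (continuous_basicVec_apply M q a β a).continuousOn.congr
    (hh β (Finset.mem_powerset.1 β.2))

theorem inv_mulVec_col_pos {M : Matrix (Fin n) (Fin n) ℝ} {a : Fin n} {β : Finset (Fin n)}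
    (h1 : 0 < (principalColumns M β).det) (h2 : 0 < (principalColumns M (insert a β)).det) :
    0 < (principalColumns M β)⁻¹.mulVec (fun i => M i a) a := by
  rw [← det_mul_inv_mulVec_col M h1.ne'] at h2
  exact pos_of_mul_pos_right h2 h1.le

theorem strictMonoOn_basicSet {M : Matrix (Fin n) (Fin n) ℝ} {q : Fin n → ℝ}
    {A : Finset (Fin n)} {a : Fin n} {h : ℝ → ℝ} {β : Finset (Fin n)}
    (hh : ∀ t ∈ basicSet M q A a β, h t = basicVec M q a β t a)
    (hpos : 0 < (principalColumns M β)⁻¹.mulVec (fun i => M i a) a) :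
    StrictMonoOn h (basicSet M q A a β) := fun x hx y hy hxy => by
  rw [hh x hx, hh y hy, basicVec_apply, basicVec_apply]
  gcongr

theorem eventually_pos_of_basicSet {M : Matrix (Fin n) (Fin n) ℝ} {q : Fin n → ℝ}
    {A : Finset (Fin n)} {a : Fin n} {h : ℝ → ℝ}
    (hh : ∀ β ⊆ A, ∀ t ∈ basicSet M q A a β, h t = basicVec M q a β t a)
    (hcov : ∀ t, ∃ β ⊆ A, t ∈ basicSet M q A a β)
    (hpos : ∀ β ⊆ A, BddAbove (basicSet M q A a β) ∨
      0 < (principalColumns M β)⁻¹.mulVec (fun i => M i a) a) :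
    ∀ᶠ t in Filter.atTop, 0 < h t := by
  have key : ∀ β ∈ A.powerset, ∀ᶠ t in Filter.atTop, t ∈ basicSet M q A a β → 0 < h t := by
    intro β hβ
    have hβ := Finset.mem_powerset.1 hβ
    rcases hpos β hβ with ⟨b, hb⟩ | hp
    · filter_upwards [Filter.eventually_gt_atTop b] with t ht htm
      exact absurd (hb htm) (not_le.2 ht)
    · have htend : Filter.Tendsto (fun t : ℝ => (principalColumns M β)⁻¹.mulVec q a +
          t * (principalColumns M β)⁻¹.mulVec (fun i => M i a) a) Filter.atTop Filter.atTop :=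
        Filter.tendsto_atTop_add_const_left _ _ (Filter.tendsto_id.atTop_mul_const hp)
      filter_upwards [htend.eventually_gt_atTop 0] with t ht htm
      rw [hh β hβ t htm, basicVec_apply]
      exact ht
  filter_upwards [(Filter.eventually_all_finset A.powerset).2 key] with t ht
  obtain ⟨β, hβ, htm⟩ := hcov t
  exact ht β (Finset.mem_powerset.2 hβ) htm

theorem existsUnique_of_eq_image {α β : Type*} {P : β → Prop} {T : Set α} {S : α → β}
    (hS : {z | P z} = S '' T) (hT : ∃! t, t ∈ T) : ∃! z, P z := by
  obtain ⟨t, ht, hu⟩ := hT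
  have hz : ∀ z, P z ↔ z ∈ S '' T := fun z => by rw [← hS]; rfl
  refine ⟨S t, (hz _).2 ⟨t, ht, rfl⟩, fun z h => ?_⟩
  obtain ⟨t', ht', rfl⟩ := (hz z).1 h
  rw [hu t' ht']

/-- A matrix with positive principal minors has uniquely solvable complementarity problems. -/
theorem existsUnique_partialLCP {M : Matrix (Fin n) (Fin n) ℝ} (A : Finset (Fin n)) :
    (∀ β ⊆ A, 0 < (principalColumns M β).det) → ∀ q, ∃! z, PartialLCP M q A z := by
  induction A using Finset.induction_on with
  | empty =>
    intro _ q
    exact ⟨0, ⟨fun _ _ => rfl, fun i hi => absurd hi (Finset.notMem_empty i)⟩,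
      fun z hz => funext fun i => hz.1 i (Finset.notMem_empty i)⟩
  | insert a A ha ih =>
    intro hdet q
    have hdet' : ∀ β ⊆ A, 0 < (principalColumns M β).det := fun β hβ =>
      hdet β (hβ.trans (Finset.subset_insert a A))
    have hpos : ∀ β ⊆ A, 0 < (principalColumns M β)⁻¹.mulVec (fun i => M i a) a :=
      fun β hβ => inv_mulVec_col_pos (hdet' β hβ) (hdet _ (Finset.insert_subset_insert a hβ))
    obtain ⟨h, S, -, hS, hh, hcov⟩ := exists_slice ha (fun β hβ => (hdet' β hβ).ne') (ih hdet') q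
    refine existsUnique_of_eq_image hS ?_
    -- Finitely many closed pieces cover the line, each with positive slope.
    have hmono : StrictMono h := fun x y hxy => lt_of_Ioo_subset_biUnion
      (isClosed_basicSet M q A a) A.powerset
      (fun β hβ => strictMonoOn_basicSet (hh β (Finset.mem_powerset.1 hβ))
        (hpos β (Finset.mem_powerset.1 hβ))) hxy
      fun t _ => by simpa using hcov t
    obtain ⟨u, hu, hu0⟩ := ((eventually_pos_of_basicSet hh hcov fun β hβ => Or.inr (hpos β hβ)).and
      (Filter.eventually_ge_atTop 0)).exists
    exact existsUnique_scalarSolution (continuousOn_of_basicSet hh hcov).continuousOn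
      (hmono.strictMonoOn _) hu0 hu

end

/-! ### Complementary cones and matrices with one exceptional principal minor -/

section
variable {n : ℕ}

theorem mem_complementaryCone_iff {M : Matrix (Fin n) (Fin n) ℝ} {α : Finset (Fin n)}
    {q : Fin n → ℝ} :
    q ∈ complementaryCone M α ↔
      ∃ p : Fin n → ℝ, (∀ j, 0 ≤ p j) ∧ (complementaryMatrix M α).mulVec p = q := by
  have h : ∀ p : Fin n → ℝ, (complementaryMatrix M α).mulVec p =
      ∑ j, p j • (fun i => complementaryMatrix M α i j) := fun p => by
    ext i
    simp [Matrix.mulVec, dotProduct, mul_comm]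
  simp only [complementaryCone, posCone, mem_ofPred_eq, h, eq_comm]

/-- Moving `q` slightly against the sum of the columns stays in the cone; adding `ε` back to each
coefficient makes all of them positive. The columns need not be independent. -/
theorem exists_pos_of_mem_interior_complementaryCone {M : Matrix (Fin n) (Fin n) ℝ}
    {α : Finset (Fin n)} {q : Fin n → ℝ} (hq : q ∈ interior (complementaryCone M α)) :
    ∃ p : Fin n → ℝ, (∀ j, 0 < p j) ∧ (complementaryMatrix M α).mulVec p = q := by
  have hc : Continuous fun ε : ℝ => q - ε • (complementaryMatrix M α).mulVec 1 := by fun_prop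
  have h0 : ∀ᶠ ε : ℝ in nhdsWithin 0 (Ioi 0),
      q - ε • (complementaryMatrix M α).mulVec 1 ∈ complementaryCone M α :=
    (hc.continuousAt.eventually_mem (by simpa using mem_interior_iff_mem_nhds.1 hq)).filter_mono
      nhdsWithin_le_nhds
  obtain ⟨ε, hε, hpos⟩ := (h0.and self_mem_nhdsWithin).exists
  obtain ⟨p, hp, hpq⟩ := mem_complementaryCone_iff.1 hε
  refine ⟨p + ε • 1, fun j => ?_, ?_⟩
  · have := hp j
    have : 0 < ε := hpos
    simp only [Pi.add_apply, Pi.smul_apply, Pi.one_apply, smul_eq_mul, mul_one]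
    linarith
  · rw [Matrix.mulVec_add, Matrix.mulVec_smul, hpq]
    abel

theorem det_complementaryMatrix_eq_zero_iff {M : Matrix (Fin n) (Fin n) ℝ}
    {α : Finset (Fin n)} : (complementaryMatrix M α).det = 0 ↔ (principalColumns M α).det = 0 := by
  have h1 : complementaryMatrix M α =
      principalColumns M α * Matrix.diagonal fun j => if j ∈ α then -1 else 1 := by
    ext i j
    rw [Matrix.mul_diagonal]
    by_cases hj : j ∈ α <;> simp [complementaryMatrix, principalColumns, hj]
  rw [h1, Matrix.det_mul, Matrix.det_diagonal]
  refine mul_eq_zero_iff_right (Finset.prod_ne_zero_iff.2 fun j _ => ?_)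
  split_ifs <;> norm_num

theorem mulVec_injective_of_det_ne_zero {C : Matrix (Fin n) (Fin n) ℝ} (hC : C.det ≠ 0) :
    Function.Injective C.mulVec :=
  Matrix.mulVec_injective_iff_isUnit.2 ((Matrix.isUnit_iff_isUnit_det C).2 (isUnit_iff_ne_zero.2 hC))

theorem isOpen_image_mulVec_pos {C : Matrix (Fin n) (Fin n) ℝ} (hC : C.det ≠ 0) :
    IsOpen (C.mulVec '' {p | ∀ j, 0 < p j}) := by
  have hu := isUnit_iff_ne_zero.2 hC
  have h1 : C.mulVec '' {p | ∀ j, 0 < p j} = C⁻¹.mulVec ⁻¹' {p | ∀ j, 0 < p j} := by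
    ext q
    constructor
    · rintro ⟨p, hp, rfl⟩
      rwa [mem_preimage, Matrix.mulVec_mulVec, Matrix.nonsing_inv_mul _ hu, Matrix.one_mulVec]
    · intro hq
      exact ⟨_, hq, by rw [Matrix.mulVec_mulVec, Matrix.mul_nonsing_inv _ hu, Matrix.one_mulVec]⟩
  rw [h1]
  refine IsOpen.preimage (by fun_prop) ?_
  simp only [ofPred_forall]
  exact isOpen_iInter_of_finite fun j => isOpen_lt continuous_const (continuous_apply j)

theorem image_mulVec_pos_subset_complementaryCone (M : Matrix (Fin n) (Fin n) ℝ)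
    (α : Finset (Fin n)) :
    (complementaryMatrix M α).mulVec '' {p | ∀ j, 0 < p j} ⊆ complementaryCone M α := by
  rintro _ ⟨p, hp, rfl⟩
  exact mem_complementaryCone_iff.2 ⟨p, fun j => (hp j).le, rfl⟩

theorem nonempty_interior_complementaryCone {M : Matrix (Fin n) (Fin n) ℝ} {α : Finset (Fin n)}
    (h : (principalColumns M α).det ≠ 0) : (interior (complementaryCone M α)).Nonempty :=
  ⟨_, interior_maximal (image_mulVec_pos_subset_complementaryCone M α)
    (isOpen_image_mulVec_pos (det_complementaryMatrix_eq_zero_iff.not.2 h)) ⟨1, by simp, rfl⟩⟩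

theorem nonempty_compl_complementaryCone [NeZero n] {M : Matrix (Fin n) (Fin n) ℝ}
    {α : Finset (Fin n)} (h : (principalColumns M α).det ≠ 0) :
    (complementaryCone M α)ᶜ.Nonempty := by
  refine ⟨(complementaryMatrix M α).mulVec (-1), fun hmem => ?_⟩
  obtain ⟨p, hp, hpq⟩ := mem_complementaryCone_iff.1 hmem
  have h1 := mulVec_injective_of_det_ne_zero (det_complementaryMatrix_eq_zero_iff.not.2 h) hpq
  have h2 := hp 0
  rw [h1] at h2
  norm_num at h2

/-- The coefficient of column `a` is the parameter `t` at which the basis `β` leaves residual zero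
in row `a`; `mem_complementaryCone_insert` is the way back. -/
theorem basicVec_of_complementaryMatrix_mulVec {M : Matrix (Fin n) (Fin n) ℝ} {a : Fin n}
    {β : Finset (Fin n)} (ha : a ∉ β) (hβ : (principalColumns M β).det ≠ 0) {p q : Fin n → ℝ}
    (hp : (complementaryMatrix M (insert a β)).mulVec p = q) :
    basicVec M q a β (p a) = fun i => if i ∈ β then -p i else if i = a then 0 else p i := by
  have hsplit : (fun j => if j ∈ insert a β then p j else 0) =
      (fun j => if j ∈ β then p j else 0) + p a • Pi.single a 1 := by
    ext j
    by_cases hj : j = a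
    · subst hj; simp [ha]
    · simp [hj]
  have hres : ∀ i, (M.mulVec (fun j => if j ∈ β then p j else 0) +
      (q + p a • fun i => M i a)) i = if i ∈ insert a β then 0 else p i := by
    intro i
    rw [← hp, Pi.add_apply, Pi.add_apply, complementaryMatrix_mulVec, hsplit, Matrix.mulVec_add,
      Matrix.mulVec_smul, Matrix.mulVec_single_one]
    simp only [Pi.add_apply, Pi.smul_apply, Matrix.col_apply]
    ring
  rw [basicVec, inv_mulVec_eq_of_complementary hβ (z := fun j => if j ∈ β then p j else 0)
    (fun i hi => if_neg hi) fun i hi => by rw [hres]; simp [hi]]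
  ext i
  by_cases hi : i ∈ β
  · simp [hi]
  · simp only [hi, if_false, hres, Finset.mem_insert, or_false]

theorem mem_complementaryCone_insert {M : Matrix (Fin n) (Fin n) ℝ} {A : Finset (Fin n)}
    {a : Fin n} (hA : insert a A = Finset.univ) {β : Finset (Fin n)} (ha : a ∉ β)
    (hβ : (principalColumns M β).det ≠ 0) {q : Fin n → ℝ} {t : ℝ} (ht0 : 0 ≤ t)
    (ht : t ∈ basicSet M q A a β) (hz : basicVec M q a β t a = 0) :
    q ∈ complementaryCone M (insert a β) := by
  have hb := mulVec_basic_add hβ (q + t • fun i => M i a)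
  rw [mem_complementaryCone_iff]
  refine ⟨fun i => if i = a then t else if i ∈ β then -basicVec M q a β t i
    else basicVec M q a β t i, fun j => ?_, ?_⟩
  · by_cases hj : j = a
    · simpa [hj] using ht0
    · have hjA : j ∈ A := by
        have := Finset.mem_univ j
        rw [← hA, Finset.mem_insert] at this
        exact this.resolve_left hj
      by_cases hjβ : j ∈ β
      · simpa [hj, hjβ] using ht.1 j hjβ
      · simpa [hj, hjβ] using ht.2 j hjA hjβ
  · ext i
    have hsplit : (fun j => if j ∈ insert a β then (if j = a then t else if j ∈ β then
        -basicVec M q a β t j else basicVec M q a β t j) else 0) =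
        (fun j => if j ∈ β then -((principalColumns M β)⁻¹.mulVec
          (q + t • fun i => M i a)) j else 0) + t • Pi.single a 1 := by
      ext j
      by_cases hj : j = a
      · subst hj; simp [ha]
      · by_cases hjβ : j ∈ β <;> simp [hj, hjβ, basicVec]
    rw [complementaryMatrix_mulVec, hsplit, Matrix.mulVec_add, Matrix.mulVec_smul,
      Matrix.mulVec_single_one]
    have hi := hb i
    simp only [Pi.add_apply, Pi.smul_apply, Matrix.col_apply, smul_eq_mul] at hi ⊢
    by_cases hia : i = a
    · subst hia
      rw [basicVec] at hz
      simp only [ha, if_false, hz, Finset.mem_insert_self, if_true] at hi ⊢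
      linarith
    · by_cases hiβ : i ∈ β
      · simp only [hiβ, if_true, Finset.mem_insert, or_true] at hi ⊢
        linarith
      · simp only [hiβ, hia, if_false, Finset.mem_insert, or_false, basicVec] at hi ⊢
        linarith

theorem exists_eq_Icc {E : Set ℝ} (hc : IsClosed E) (ho : E.OrdConnected) (hne : E.Nonempty)
    (hb : BddAbove E) (h0 : E ⊆ Ici 0) : ∃ s u, 0 ≤ s ∧ s ≤ u ∧ E = Icc s u := by
  obtain ⟨b, hb⟩ := hb
  have hcomp : IsCompact E := isCompact_Icc.of_isClosed_subset hc fun x hx => ⟨h0 hx, hb hx⟩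
  have hE := eq_Icc_of_connected_compact ⟨hne, ho.isPreconnected⟩ hcomp
  refine ⟨_, _, h0 (hcomp.sInf_mem hne), ?_, hE⟩
  rwa [← nonempty_Icc, ← hE]

/-- Between two points of `I` the exceptional piece never occurs, so pieces of positive slope
suffice to cover. -/
theorem strictMonoOn_of_basicSet {M : Matrix (Fin n) (Fin n) ℝ} {q : Fin n → ℝ}
    {A : Finset (Fin n)} {a : Fin n} {β₀ : Finset (Fin n)} {h : ℝ → ℝ}
    (hh : ∀ β ⊆ A, ∀ t ∈ basicSet M q A a β, h t = basicVec M q a β t a)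
    (hcov : ∀ t, ∃ β ⊆ A, t ∈ basicSet M q A a β)
    (hpos : ∀ β ⊆ A, β ≠ β₀ → 0 < (principalColumns M β)⁻¹.mulVec (fun i => M i a) a)
    {I : Set ℝ} (hI : ∀ x ∈ I, ∀ y ∈ I, ∀ t ∈ Ioo x y, t ∉ basicSet M q A a β₀) :
    StrictMonoOn h I := fun x hx y hy hxy => by
  refine lt_of_Ioo_subset_biUnion (isClosed_basicSet M q A a) (A.powerset.erase β₀)
    (fun β hβ => ?_) hxy fun t ht => ?_
  · rw [Finset.mem_erase, Finset.mem_powerset] at hβ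
    exact strictMonoOn_basicSet (hh β hβ.2) (hpos β hβ.2 hβ.1)
  · obtain ⟨β, hβ, htβ⟩ := hcov t
    refine ⟨β, Finset.mem_erase.2 ⟨?_, Finset.mem_powerset.2 hβ⟩, htβ⟩
    rintro rfl
    exact hI x hx y hy t ht htβ

theorem bddAbove_basicSet {M : Matrix (Fin n) (Fin n) ℝ} {q : Fin n → ℝ}
    {A : Finset (Fin n)} {a : Fin n} {β : Finset (Fin n)} {i : Fin n} (hi : i ∈ A) (hiβ : i ∉ β)
    (hneg : (principalColumns M β)⁻¹.mulVec (fun i => M i a) i < 0) :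
    BddAbove (basicSet M q A a β) := by
  refine ⟨(principalColumns M β)⁻¹.mulVec q i /
    -(principalColumns M β)⁻¹.mulVec (fun i => M i a) i, fun t ht => ?_⟩
  have h1 := ht.2 i hi hiβ
  rw [basicVec_apply] at h1
  rw [le_div_iff₀ (neg_pos.2 hneg)]
  linarith

/-- All principal minors are positive, except possibly the one on `insert a β₀`, and the basis
`β₀` becomes infeasible as the variable `a` grows. -/
structure IsAlmostP (M : Matrix (Fin n) (Fin n) ℝ) (A : Finset (Fin n)) (a : Fin n)
    (β₀ : Finset (Fin n)) : Prop where
  notMem : a ∉ A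
  insert_eq : insert a A = Finset.univ
  subset : β₀ ⊆ A
  det_pos : ∀ α, α ≠ insert a β₀ → 0 < (principalColumns M α).det
  infeasible : ∃ i ∈ A, i ∉ β₀ ∧ (principalColumns M β₀)⁻¹.mulVec (fun i => M i a) i < 0

namespace IsAlmostP
variable {M : Matrix (Fin n) (Fin n) ℝ} {A : Finset (Fin n)} {a : Fin n} {β₀ : Finset (Fin n)}

theorem det_pos_of_subset (hM : IsAlmostP M A a β₀) {β : Finset (Fin n)} (hβ : β ⊆ A) :
    0 < (principalColumns M β).det :=
  hM.det_pos β fun h => hM.notMem (hβ (h ▸ Finset.mem_insert_self a β₀))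

theorem slope_pos (hM : IsAlmostP M A a β₀) {β : Finset (Fin n)} (hβ : β ⊆ A) (hne : β ≠ β₀) :
    0 < (principalColumns M β)⁻¹.mulVec (fun i => M i a) a := by
  refine inv_mulVec_col_pos (hM.det_pos_of_subset hβ) (hM.det_pos _ fun h => hne ?_)
  rw [← Finset.erase_insert fun h => hM.notMem (hβ h), h,
    Finset.erase_insert fun h => hM.notMem (hM.subset h)]

theorem exists_slice (hM : IsAlmostP M A a β₀) (q : Fin n → ℝ) :
    ∃ (h : ℝ → ℝ) (S : ℝ → Fin n → ℝ), Function.Injective S ∧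
      {z | IsLCPSolution M q z} = S '' scalarSolutions h ∧
      (∀ β ⊆ A, ∀ t ∈ basicSet M q A a β, h t = basicVec M q a β t a) ∧
      ∀ t, ∃ β ⊆ A, t ∈ basicSet M q A a β := by
  simp only [isLCPSolution_iff_partialLCP, ← hM.insert_eq]
  exact _root_.exists_slice hM.notMem (fun β hβ => (hM.det_pos_of_subset hβ).ne')
    (existsUnique_partialLCP A fun β hβ => hM.det_pos_of_subset hβ) q

theorem bddAbove (hM : IsAlmostP M A a β₀) (q : Fin n → ℝ) :
    BddAbove (basicSet M q A a β₀) := by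
  obtain ⟨i, hi, hiβ, hneg⟩ := hM.infeasible
  exact bddAbove_basicSet hi hiβ hneg

theorem exists_pos_gt (hM : IsAlmostP M A a β₀) {q : Fin n → ℝ} {h : ℝ → ℝ}
    (hh : ∀ β ⊆ A, ∀ t ∈ basicSet M q A a β, h t = basicVec M q a β t a)
    (hcov : ∀ t, ∃ β ⊆ A, t ∈ basicSet M q A a β) (b : ℝ) : ∃ u, b < u ∧ 0 < h u := by
  have hpos : ∀ᶠ t in Filter.atTop, 0 < h t := eventually_pos_of_basicSet hh hcov fun β hβ => by
    by_cases hne : β = β₀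
    · exact Or.inl (hne ▸ hM.bddAbove q)
    · exact Or.inr (hM.slope_pos hβ hne)
  exact ((Filter.eventually_gt_atTop b).and hpos).exists

theorem existsUnique_of_notMem (hM : IsAlmostP M A a β₀) {q : Fin n → ℝ}
    (hq : q ∉ complementaryCone M (insert a β₀)) : ∃! z, IsLCPSolution M q z := by
  obtain ⟨h, S, -, hS, hh, hcov⟩ := hM.exists_slice q
  refine existsUnique_of_eq_image hS ?_
  have hc := (continuousOn_of_basicSet hh hcov).continuousOn (s := Ici 0)
  -- No sign of the exceptional minor is needed: on the exceptional piece it is enough that `h` has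
  -- no zero.
  have hz : ∀ t ∈ basicSet M q A a β₀, 0 ≤ t → h t ≠ 0 := fun t ht ht0 h0 => by
    rw [hh β₀ hM.subset t ht] at h0
    exact hq (mem_complementaryCone_insert hM.insert_eq (fun h => hM.notMem (hM.subset h))
      (hM.det_pos_of_subset hM.subset).ne' ht0 ht h0)
  have hmono := fun I => strictMonoOn_of_basicSet (I := I) hh hcov fun β hβ => hM.slope_pos hβ
  rcases (basicSet M q A a β₀ ∩ Ici 0).eq_empty_or_nonempty with hE | hE
  · obtain ⟨u, hu0, hu⟩ := hM.exists_pos_gt hh hcov 0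
    refine existsUnique_scalarSolution hc (hmono _ fun x hx y _ t ht hmem => ?_) hu0.le hu
    exact eq_empty_iff_forall_notMem.1 hE t ⟨hmem, le_trans hx ht.1.le⟩
  · obtain ⟨s, u, hs, hsu, hIcc⟩ := exists_eq_Icc
      ((isClosed_basicSet M q A a β₀).inter isClosed_Ici)
      ((ordConnected_basicSet M q A a β₀).inter ordConnected_Ici) hE
      ((hM.bddAbove q).mono inter_subset_left) inter_subset_right
    obtain ⟨v, hv, hv0⟩ := hM.exists_pos_gt hh hcov u
    refine existsUnique_scalarSolution_of_ne_zero_on_Icc hc hs hsu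
      (hmono _ fun x hx y hy t ht hmem => ?_) (hmono _ fun x hx y _ t ht hmem => ?_)
      (fun t ht => ?_) hv hv0
    · have : t ∈ Icc s u := hIcc ▸ ⟨hmem, hx.1.trans ht.1.le⟩
      exact absurd (this.1.trans_lt ht.2) (not_lt.2 hy.2)
    · have : t ∈ Icc s u := hIcc ▸ ⟨hmem, (hs.trans hsu).trans (le_trans hx ht.1.le)⟩
      exact absurd (ht.1.trans_le this.2) (not_lt.2 hx)
    · rw [← hIcc] at ht
      exact hz t ht.1 ht.2

theorem ncard_eq_three (hM : IsAlmostP M A a β₀) (hneg : (principalColumns M (insert a β₀)).det < 0)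
    {q : Fin n → ℝ} (hq : q ∈ interior (complementaryCone M (insert a β₀))) :
    {z | IsLCPSolution M q z}.ncard = 3 := by
  obtain ⟨h, S, hSinj, hS, hh, hcov⟩ := hM.exists_slice q
  rw [hS, ncard_image_of_injective _ hSinj]
  have ha : a ∉ β₀ := fun h => hM.notMem (hM.subset h)
  have hdet := hM.det_pos_of_subset hM.subset
  obtain ⟨p, hp, hpq⟩ := exists_pos_of_mem_interior_complementaryCone hq
  have hx := basicVec_of_complementaryMatrix_mulVec ha hdet.ne' hpq
  -- Positive coefficients turn the constraints of `β₀` at `p a` into strict inequalities, so they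
  -- persist nearby.
  have hnhds : basicSet M q A a β₀ ∩ Ici 0 ∈ nhds (p a) := by
    refine Filter.inter_mem ?_ (Ici_mem_nhds (hp a))
    have h1 : ∀ᶠ t in nhds (p a), ∀ i, i ∈ β₀ → basicVec M q a β₀ t i < 0 := by
      refine Filter.eventually_all.2 fun i => ?_
      by_cases hi : i ∈ β₀
      · refine ((continuous_basicVec_apply M q a β₀ i).continuousAt.eventually_lt_const
          (u := 0) ?_).mono fun t ht _ => ht
        beta_reduce
        rw [hx]; simpa [hi] using hp i
      · exact Filter.Eventually.of_forall fun t h => absurd h hi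
    have h2 : ∀ᶠ t in nhds (p a), ∀ i, i ∈ A → i ∉ β₀ → 0 < basicVec M q a β₀ t i := by
      refine Filter.eventually_all.2 fun i => ?_
      by_cases hi : i ∈ A ∧ i ∉ β₀
      · refine ((continuous_basicVec_apply M q a β₀ i).continuousAt.eventually_const_lt
          (u := 0) ?_).mono fun t ht _ _ => ht
        have hia : i ≠ a := fun h => hM.notMem (h ▸ hi.1)
        beta_reduce
        rw [hx]; simpa [hi.2, hia] using hp i
      · exact Filter.Eventually.of_forall fun t h h' => absurd ⟨h, h'⟩ hi
    filter_upwards [h1, h2] with t ht1 ht2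
    exact ⟨fun i hi => (ht1 i hi).le, fun i hi hiβ => (ht2 i hi hiβ).le⟩
  obtain ⟨s, u, hs, hsu, hIcc⟩ := exists_eq_Icc
    ((isClosed_basicSet M q A a β₀).inter isClosed_Ici)
    ((ordConnected_basicSet M q A a β₀).inter ordConnected_Ici) ⟨_, mem_of_mem_nhds hnhds⟩
    ((hM.bddAbove q).mono inter_subset_left) inter_subset_right
  have hmono := fun I => strictMonoOn_of_basicSet (I := I) hh hcov fun β hβ => hM.slope_pos hβ
  have hslope : (principalColumns M β₀)⁻¹.mulVec (fun i => M i a) a < 0 := by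
    rw [← det_mul_inv_mulVec_col M hdet.ne'] at hneg
    exact neg_of_mul_neg_right hneg hdet.le
  have hEh : ∀ t ∈ Icc s u, h t = basicVec M q a β₀ t a := fun t ht => by
    rw [← hIcc] at ht
    exact hh β₀ hM.subset t ht.1
  obtain ⟨v, hv, hv0⟩ := hM.exists_pos_gt hh hcov u
  have hIoo : p a ∈ Ioo s u := Icc_mem_nhds_iff.1 (hIcc ▸ hnhds)
  refine ncard_scalarSolutions_eq_three (continuousOn_of_basicSet hh hcov).continuousOn hs
    hIoo.1 hIoo.2 (hmono _ fun x hx y hy t ht hmem => ?_) (hmono _ fun x hx y _ t ht hmem => ?_)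
    (fun x hx y hy hxy => ?_) ?_ hv hv0
  · have : t ∈ Icc s u := hIcc ▸ ⟨hmem, hx.1.trans ht.1.le⟩
    exact absurd (this.1.trans_lt ht.2) (not_lt.2 hy.2)
  · have : t ∈ Icc s u := hIcc ▸ ⟨hmem, (hs.trans hsu).trans (le_trans hx ht.1.le)⟩
    exact absurd (ht.1.trans_le this.2) (not_lt.2 hx)
  · rw [hEh x hx, hEh y hy, basicVec_apply, basicVec_apply]
    have := mul_lt_mul_of_neg_right hxy hslope
    linarith
  · rw [hEh _ ⟨hIoo.1.le, hIoo.2.le⟩, hx]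
    simp [ha]

end IsAlmostP

end

/-! ### Counting disjoint members of the field of sets, and instability -/

section
variable {n : ℕ}

theorem isOpen_compl_range_mulVec (C : Matrix (Fin n) (Fin n) ℝ) :
    IsOpen (range C.mulVec)ᶜ := by
  have h : IsClosed (LinearMap.range C.mulVecLin : Set (Fin n → ℝ)) :=
    Submodule.closed_of_finiteDimensional _
  rw [LinearMap.coe_range] at h
  exact h.isOpen_compl

theorem dense_compl_range_mulVec {C : Matrix (Fin n) (Fin n) ℝ} (hC : C.det = 0) :
    Dense (range C.mulVec)ᶜ := by
  rw [← interior_eq_empty_iff_dense_compl, ← not_nonempty_iff_eq_empty]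
  intro hne
  have h : (interior (LinearMap.range C.mulVecLin : Set (Fin n → ℝ))).Nonempty := by
    rwa [LinearMap.coe_range]
  have hsurj : Function.Surjective C.mulVec :=
    LinearMap.range_eq_top.1 (Submodule.eq_top_of_nonempty_interior' _ h)
  have hunit := (Matrix.isUnit_iff_isUnit_det C).1 (Matrix.mulVec_surjective_iff_isUnit.1 hsurj)
  exact hunit.ne_zero hC

theorem mulVec_mem_range_updateCol_zero (C : Matrix (Fin n) (Fin n) ℝ) {p : Fin n → ℝ}
    {i : Fin n} (hp : p i = 0) : C.mulVec p ∈ range (C.updateCol i 0).mulVec := by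
  refine ⟨p, funext fun k => ?_⟩
  simp only [Matrix.mulVec, dotProduct]
  refine Finset.sum_congr rfl fun j _ => ?_
  by_cases hj : j = i
  · subst hj; simp [hp]
  · simp [hj]

theorem residual_of_complementaryMatrix_mulVec {M : Matrix (Fin n) (Fin n) ℝ}
    {α : Finset (Fin n)} {p q : Fin n → ℝ} (hp : (complementaryMatrix M α).mulVec p = q)
    (i : Fin n) :
    (M.mulVec (fun j => if j ∈ α then p j else 0) + q) i = if i ∈ α then 0 else p i := by
  rw [← hp, Pi.add_apply, complementaryMatrix_mulVec]
  ring

theorem isLCPSolution_of_complementaryMatrix_mulVec {M : Matrix (Fin n) (Fin n) ℝ}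
    {α : Finset (Fin n)} {p q : Fin n → ℝ} (hp : (complementaryMatrix M α).mulVec p = q)
    (h0 : ∀ j, 0 ≤ p j) : IsLCPSolution M q fun j => if j ∈ α then p j else 0 := by
  refine ⟨fun i => ?_, fun i => ?_, Finset.sum_eq_zero fun i _ => ?_⟩
  · rw [residual_of_complementaryMatrix_mulVec hp]
    split_ifs
    exacts [le_rfl, h0 i]
  · beta_reduce
    split_ifs
    exacts [h0 i, le_rfl]
  · rw [residual_of_complementaryMatrix_mulVec hp]
    by_cases hi : i ∈ α <;> simp [hi]

theorem exists_mem_complementaryCone {M : Matrix (Fin n) (Fin n) ℝ} {q z : Fin n → ℝ}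
    (hz : IsLCPSolution M q z) : ∃ α, q ∈ complementaryCone M α := by
  classical
  rw [isLCPSolution_iff_partialLCP] at hz
  have hz := fun i => hz.2 i (Finset.mem_univ i)
  obtain ⟨α, hα⟩ : ∃ α : Finset (Fin n), ∀ i, i ∈ α ↔ (M.mulVec z + q) i = 0 :=
    ⟨Finset.univ.filter fun i => (M.mulVec z + q) i = 0, by simp⟩
  refine ⟨α, mem_complementaryCone_iff.2
    ⟨fun i => if i ∈ α then z i else (M.mulVec z + q) i, fun j => ?_, ?_⟩⟩
  · beta_reduce
    split_ifs
    exacts [(hz j).1, (hz j).2.1]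
  · ext i
    have h1 : (fun j => if j ∈ α then (if j ∈ α then z j else (M.mulVec z + q) j) else 0) = z := by
      ext j
      by_cases hj : j ∈ α
      · simp [hj]
      · simp [hj, (mul_eq_zero.1 (hz j).2.2).resolve_right ((hα j).not.1 hj)]
    rw [complementaryMatrix_mulVec, h1]
    by_cases hi : i ∈ α
    · have : M.mulVec z i + q i = 0 := (hα i).1 hi
      simp only [hi, if_true]
      linarith
    · simp only [hi, if_false, Pi.add_apply]
      ring

/-- If the problem is uniquely solvable, a point of two complementary cones lies on the boundary
of both. -/
theorem exists_eq_zero_of_mem_two_cones {M : Matrix (Fin n) (Fin n) ℝ} {q : Fin n → ℝ}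
    (hq : ∃! z, IsLCPSolution M q z) {α β : Finset (Fin n)} (hαβ : α ≠ β) {p : Fin n → ℝ}
    (hp : (complementaryMatrix M α).mulVec p = q) (h0 : ∀ j, 0 ≤ p j)
    (hβ : q ∈ complementaryCone M β) : ∃ i, p i = 0 := by
  obtain ⟨p', hp'0, hp'⟩ := mem_complementaryCone_iff.1 hβ
  have hz := hq.unique (isLCPSolution_of_complementaryMatrix_mulVec hp h0)
    (isLCPSolution_of_complementaryMatrix_mulVec hp' hp'0)
  obtain ⟨i, hi⟩ : ∃ i, ¬(i ∈ α ↔ i ∈ β) := by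
    by_contra! h
    exact hαβ (Finset.ext h)
  refine ⟨i, ?_⟩
  have h1 := residual_of_complementaryMatrix_mulVec hp i
  rw [hz, residual_of_complementaryMatrix_mulVec hp' i] at h1
  have h2 := congrFun hz i
  by_cases hiα : i ∈ α <;> by_cases hiβ : i ∈ β <;> simp_all

theorem mem_iff_mem_of_mem_lcpField {M : Matrix (Fin n) (Fin n) ℝ} {P : Set (Fin n → ℝ)}
    (hP : P ∈ lcpField M) {q q' : Fin n → ℝ}
    (h : ∀ α, q ∈ complementaryCone M α ↔ q' ∈ complementaryCone M α) : q ∈ P ↔ q' ∈ P := by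
  induction hP with
  | base s hs =>
    obtain ⟨α, rfl⟩ := hs
    exact h α
  | empty => rfl
  | compl s _ ih => exact not_congr ih
  | union s t _ _ ihs iht => exact or_congr ihs iht

/-- Off a degenerate cone where the solution is unique, a generic point lies in exactly one
complementary cone. -/
theorem dense_existsUnique_complementaryCone {M : Matrix (Fin n) (Fin n) ℝ}
    {α₀ : Finset (Fin n)} (h0 : (principalColumns M α₀).det = 0)
    (huniq : ∀ q, q ∉ complementaryCone M α₀ → ∃! z, IsLCPSolution M q z) :
    Dense {q | ∃ α, α ≠ α₀ ∧ ∀ β, q ∈ complementaryCone M β ↔ β = α} := by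
  -- A coefficient vector with a zero entry sends `q` into the range of a matrix with a zeroed
  -- column. These finitely many proper subspaces have dense open complements.
  have h1 : Dense (⋂ x : Finset (Fin n) × Fin n,
      (range ((complementaryMatrix M x.1).updateCol x.2 0).mulVec)ᶜ) :=
    dense_iInter_of_isOpen (fun x => isOpen_compl_range_mulVec _) fun x =>
      dense_compl_range_mulVec (Matrix.det_eq_zero_of_column_eq_zero x.2 (by simp))
  have h2 := (dense_compl_range_mulVec (det_complementaryMatrix_eq_zero_iff.2 h0)).inter_of_isOpen_left
    h1 (isOpen_compl_range_mulVec _)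
  refine h2.mono fun q hq => ?_
  have hq1 : ∀ α i, q ∉ range ((complementaryMatrix M α).updateCol i 0).mulVec :=
    fun α i => mem_iInter.1 hq.2 (α, i)
  have hq0 : q ∉ complementaryCone M α₀ := fun h => by
    obtain ⟨p, -, hp⟩ := mem_complementaryCone_iff.1 h
    exact hq.1 ⟨p, hp⟩
  obtain ⟨z, hz, -⟩ := huniq q hq0
  obtain ⟨α, hα⟩ := exists_mem_complementaryCone hz
  refine ⟨α, fun h => hq0 (h ▸ hα), fun β => ⟨fun hβ => ?_, fun h => h ▸ hα⟩⟩
  by_contra hne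
  obtain ⟨p, hp0, hp⟩ := mem_complementaryCone_iff.1 hβ
  obtain ⟨i, hi⟩ := exists_eq_zero_of_mem_two_cones (huniq q hq0) hne hp hp0 hα
  exact hq1 β i (hp ▸ mulVec_mem_range_updateCol_zero _ hi)

/-- Pigeonhole: choose in each interior a generic point and record its only cone. Points with the
same cone belong to the same members of the field, so disjointness would make this map injective,
hence onto, although it omits `α₀`. -/
theorem not_pairwise_disjoint_lcpField {M : Matrix (Fin n) (Fin n) ℝ}
    {α₀ : Finset (Fin n)} (h0 : (principalColumns M α₀).det = 0)
    (huniq : ∀ q, q ∉ complementaryCone M α₀ → ∃! z, IsLCPSolution M q z)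
    {P : Finset (Fin n) → Set (Fin n → ℝ)} (hP : ∀ α, P α ∈ lcpField M)
    (hint : ∀ α, (interior (P α)).Nonempty) : ¬Pairwise fun α β => Disjoint (P α) (P β) := by
  intro hdisj
  choose q hqint hq using fun α =>
    (dense_existsUnique_complementaryCone h0 huniq).inter_open_nonempty _ isOpen_interior (hint α)
  choose j hj0 hj using hq
  have hinj : Function.Injective j := fun α β hαβ => by
    by_contra hne
    have h1 : q α ∈ P β := (mem_iff_mem_of_mem_lcpField (hP β) (q := q α) (q' := q β)
      fun γ => by rw [hj, hj, hαβ]).2 (interior_subset (hqint β))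
    exact disjoint_left.1 (hdisj hne) (interior_subset (hqint α)) h1
  obtain ⟨α, hα⟩ := Finite.surjective_of_injective hinj α₀
  exact hj0 α hα

theorem exists_pairwise_disjoint_lcpField {N : Matrix (Fin n) (Fin n) ℝ}
    (hdet : ∀ α, (principalColumns N α).det ≠ 0) (huniq : ∀ q, ∃! z, IsLCPSolution N q z) :
    ∃ P : Finset (Fin n) → Set (Fin n → ℝ), (∀ α, P α ∈ lcpField N) ∧
      (∀ α, (interior (P α)).Nonempty) ∧ Pairwise fun α β => Disjoint (P α) (P β) := by
  have hcone : ∀ α, complementaryCone N α ∈ lcpField N := fun α =>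
    MeasureTheory.self_subset_generateSetAlgebra ⟨α, rfl⟩
  have hfield : MeasureTheory.IsSetAlgebra (lcpField N) :=
    MeasureTheory.isSetAlgebra_generateSetAlgebra
  -- Each cone minus all the others; it still contains the open set of strictly positive
  -- combinations.
  refine ⟨fun α => complementaryCone N α \ ⋃ β ∈ Finset.univ.erase α, complementaryCone N β,
    fun α => hfield.sdiff_mem (hcone α) (hfield.biUnion_mem _ fun β _ => hcone β), fun α => ?_,
    fun α β hαβ => disjoint_left.2 fun q hq hq' => hq.2 ?_⟩
  · refine Nonempty.mono (interior_maximal (fun q hq => ?_) (isOpen_image_mulVec_pos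
      (det_complementaryMatrix_eq_zero_iff.not.2 (hdet α)))) ⟨_, 1, by simp, rfl⟩
    refine ⟨image_mulVec_pos_subset_complementaryCone N α hq, ?_⟩
    obtain ⟨p, hp, hpq⟩ := hq
    simp only [mem_iUnion, not_exists]
    intro β hβ hqβ
    obtain ⟨i, hi⟩ := exists_eq_zero_of_mem_two_cones (huniq q) (Finset.ne_of_mem_erase hβ).symm
      hpq (fun j => (hp j).le) hqβ
    exact (hp i).ne' hi
  · exact mem_biUnion (Finset.mem_coe.2 (Finset.mem_erase.2 ⟨hαβ.symm, Finset.mem_univ β⟩)) hq'.1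

theorem not_lcpEquivalent {M N : Matrix (Fin n) (Fin n) ℝ}
    {α₀ : Finset (Fin n)} (h0 : (principalColumns M α₀).det = 0)
    (huniq : ∀ q, q ∉ complementaryCone M α₀ → ∃! z, IsLCPSolution M q z)
    (hdet : ∀ α, (principalColumns N α).det ≠ 0) (huniqN : ∀ q, ∃! z, IsLCPSolution N q z) :
    ¬LCPEquivalent M N := by
  rintro ⟨φ, hφ⟩
  obtain ⟨P, hP, hint, hdisj⟩ := exists_pairwise_disjoint_lcpField hdet huniqN
  choose Q hQ hQP using fun α => hφ.bijOn.surjOn (hP α)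
  have hQP : ∀ α, φ ⁻¹' Q α = P α := hQP
  refine not_pairwise_disjoint_lcpField h0 huniq hQ (fun α => ?_) fun α β hαβ => ?_
  · have h1 := hint α
    rw [← hQP, ← φ.preimage_interior] at h1
    obtain ⟨x, hx⟩ := h1
    exact ⟨φ x, hx⟩
  · have h1 : Disjoint (P α) (P β) := hdisj hαβ
    rw [← hQP, ← hQP] at h1
    exact Disjoint.of_preimage φ.surjective h1

end

/-! ### Principal minors of the circuit matrix -/

theorem Matrix.det_fin_four_expansion (M : Matrix (Fin 4) (Fin 4) ℝ) : M.det =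
    M 0 0 * (M 1 1 * (M 2 2 * M 3 3 - M 2 3 * M 3 2) - M 1 2 * (M 2 1 * M 3 3 - M 2 3 * M 3 1)
      + M 1 3 * (M 2 1 * M 3 2 - M 2 2 * M 3 1))
    - M 0 1 * (M 1 0 * (M 2 2 * M 3 3 - M 2 3 * M 3 2) - M 1 2 * (M 2 0 * M 3 3 - M 2 3 * M 3 0)
      + M 1 3 * (M 2 0 * M 3 2 - M 2 2 * M 3 0))
    + M 0 2 * (M 1 0 * (M 2 1 * M 3 3 - M 2 3 * M 3 1) - M 1 1 * (M 2 0 * M 3 3 - M 2 3 * M 3 0)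
      + M 1 3 * (M 2 0 * M 3 1 - M 2 1 * M 3 0))
    - M 0 3 * (M 1 0 * (M 2 1 * M 3 2 - M 2 2 * M 3 1) - M 1 1 * (M 2 0 * M 3 2 - M 2 2 * M 3 0)
      + M 1 2 * (M 2 0 * M 3 1 - M 2 1 * M 3 0)) := by
  have h10 : (1 : Fin 4).succAbove (0 : Fin 3) = 0 := rfl
  have h11 : (1 : Fin 4).succAbove (1 : Fin 3) = 2 := rfl
  have h12 : (1 : Fin 4).succAbove (2 : Fin 3) = 3 := rfl
  have h20 : (2 : Fin 4).succAbove (0 : Fin 3) = 0 := rfl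
  have h21 : (2 : Fin 4).succAbove (1 : Fin 3) = 1 := rfl
  have h22 : (2 : Fin 4).succAbove (2 : Fin 3) = 3 := rfl
  have h30 : (3 : Fin 4).succAbove (0 : Fin 3) = 0 := rfl
  have h31 : (3 : Fin 4).succAbove (1 : Fin 3) = 1 := rfl
  have h32 : (3 : Fin 4).succAbove (2 : Fin 3) = 2 := rfl
  rw [Matrix.det_succ_row_zero]
  simp [Fin.sum_univ_four, Matrix.det_fin_three, h10, h11, h12, h20, h21, h22, h30, h31, h32]
  ring

/-- The circuit matrix in terms of `f = (1 - αF) / αF` and `r = (1 - αR) / αR`. -/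
theorem circuitMatrix_eq {G0a G1a G2a G0b G1b G2b G1 G2 αF αR : ℝ} (hF : αF ≠ 0) (hR : αR ≠ 0)
    {f r : ℝ} (hf : f = (1 - αF) / αF) (hr : r = (1 - αR) / αR) :
    circuitMatrix G0a G1a G2a G0b G1b G2b G1 G2 αF αR =
      !![(1 + f) * G0a + f * (G2a + G2), G1a + G1 - f * (G2a + G2), -G1, G1 - f * G2;
        G0a - r * (G2a + G2), (1 + r) * (G1a + G1) + r * (G2a + G2), -(1 + r) * G1,
          (1 + r) * G1 + r * G2;
        -G2, G2 - f * G1, (1 + f) * G0b + f * (G2b + G1), G1b + G2 - f * (G2b + G1);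
        -(1 + r) * G2, (1 + r) * G2 + r * G1, G0b - r * (G2b + G1),
          (1 + r) * (G1b + G2) + r * (G2b + G1)] := by
  subst hf hr
  ext i j
  fin_cases i <;> fin_cases j <;> simp [circuitMatrix] <;> field_simp <;> ring

-- In terms of `f` and `r`, all negative terms cancel in these fifteen minors, leaving polynomials
-- with positive coefficients in positive quantities.
set_option maxRecDepth 4000 in
set_option maxHeartbeats 1000000 in
theorem det_principalColumns_circuitMatrix_pos {G0a G1a G2a G0b G1b G2b G1 G2 αF αR : ℝ}
    (hG0a : 0 < G0a) (hG1a : 0 < G1a) (hG2a : 0 < G2a)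
    (hG0b : 0 < G0b) (hG1b : 0 < G1b) (hG2b : 0 < G2b) (hG1 : 0 < G1) (hG2 : 0 < G2)
    (hαF : αF ∈ Ioo (0 : ℝ) 1) (hαR : αR ∈ Ioo (0 : ℝ) 1) {α : Finset (Fin 4)}
    (hα : α ≠ {0, 2}) :
    0 < (principalColumns (circuitMatrix G0a G1a G2a G0b G1b G2b G1 G2 αF αR) α).det := by
  obtain ⟨f, hf⟩ : ∃ f, f = (1 - αF) / αF := ⟨_, rfl⟩
  obtain ⟨r, hr⟩ : ∃ r, r = (1 - αR) / αR := ⟨_, rfl⟩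
  have hf0 : 0 < f := hf ▸ div_pos (sub_pos.2 hαF.2) hαF.1
  have hr0 : 0 < r := hr ▸ div_pos (sub_pos.2 hαR.2) hαR.1
  rw [circuitMatrix_eq hαF.1.ne' hαR.1.ne' hf hr]
  clear hf hr hαF hαR
  have hα' : ¬(0 ∈ α ∧ 1 ∉ α ∧ 2 ∈ α ∧ 3 ∉ α) := fun ⟨h0, h1, h2, h3⟩ =>
    hα (Finset.ext fun i => by fin_cases i <;> simp [h0, h1, h2, h3])
  by_cases h0 : 0 ∈ α <;> by_cases h1 : 1 ∈ α <;> by_cases h2 : 2 ∈ α <;> by_cases h3 : 3 ∈ α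
  all_goals
    first
    | exact (hα' ⟨h0, h1, h2, h3⟩).elim
    | (rw [Matrix.det_fin_four_expansion]
       simp [principalColumns, h0, h1, h2, h3]
       all_goals
         rw [← sub_pos]
         ring_nf
         positivity)

theorem det_principalColumns_circuitMatrix {G0a G1a G2a G0b G1b G2b G1 G2 αF αR : ℝ}
    (hF : αF ≠ 0) :
    αF ^ 2 * (principalColumns
      (circuitMatrix G0a G1a G2a G0b G1b G2b G1 G2 αF αR) {0, 2}).det =
      circuitGamma G0a G2a G0b G2b G1 G2 αF := by
  rw [Matrix.det_fin_four_expansion]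
  simp [principalColumns, circuitMatrix, circuitGamma]
  field_simp
  ring

theorem isAlmostP_circuitMatrix {G0a G1a G2a G0b G1b G2b G1 G2 αF αR : ℝ}
    (hG0a : 0 < G0a) (hG1a : 0 < G1a) (hG2a : 0 < G2a)
    (hG0b : 0 < G0b) (hG1b : 0 < G1b) (hG2b : 0 < G2b) (hG1 : 0 < G1) (hG2 : 0 < G2)
    (hαF : αF ∈ Ioo (0 : ℝ) 1) (hαR : αR ∈ Ioo (0 : ℝ) 1)
    (hγ : circuitGamma G0a G2a G0b G2b G1 G2 αF ≤ 0) :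
    IsAlmostP (circuitMatrix G0a G1a G2a G0b G1b G2b G1 G2 αF αR) {1, 2, 3} 0 {2} where
  notMem := by decide
  insert_eq := by decide
  subset := by decide
  det_pos α hα :=
    det_principalColumns_circuitMatrix_pos hG0a hG1a hG2a hG0b hG1b hG2b hG1 hG2 hαF hαR hα
  infeasible := by
    have hdet2 := det_principalColumns_circuitMatrix_pos hG0a hG1a hG2a hG0b hG1b hG2b hG1 hG2
      hαF hαR (α := {2}) (by decide)
    have hdet : (principalColumns
        (circuitMatrix G0a G1a G2a G0b G1b G2b G1 G2 αF αR) {0, 2}).det ≤ 0 := by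
      rw [← det_principalColumns_circuitMatrix (G1a := G1a) (G1b := G1b) (αR := αR)
        hαF.1.ne'] at hγ
      exact nonpos_of_mul_nonpos_right hγ (pow_pos hαF.1 2)
    refine ⟨1, by decide, by decide, ?_⟩
    -- The inverse is not computed: rows `1` and `2` of the system defining `v` already determine `v
    -- 1`.
    have hv := Matrix.mulVec_mulVec (fun i => circuitMatrix G0a G1a G2a G0b G1b G2b G1 G2 αF αR i 0)
      (principalColumns (circuitMatrix G0a G1a G2a G0b G1b G2b G1 G2 αF αR) {2})
      (principalColumns (circuitMatrix G0a G1a G2a G0b G1b G2b G1 G2 αF αR) {2})⁻¹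
    rw [Matrix.mul_nonsing_inv _ (isUnit_iff_ne_zero.2 hdet2.ne'), Matrix.one_mulVec] at hv
    generalize (principalColumns (circuitMatrix G0a G1a G2a G0b G1b G2b G1 G2 αF αR) {2})⁻¹.mulVec
      (fun i => circuitMatrix G0a G1a G2a G0b G1b G2b G1 G2 αF αR i 0) = v at hv ⊢
    have h1 := congrFun hv 1
    have h2 := congrFun hv 2
    clear hγ hv hdet2
    obtain ⟨f, hf⟩ : ∃ f, f = (1 - αF) / αF := ⟨_, rfl⟩
    obtain ⟨r, hr⟩ : ∃ r, r = (1 - αR) / αR := ⟨_, rfl⟩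
    have hf0 : 0 < f := hf ▸ div_pos (sub_pos.2 hαF.2) hαF.1
    have hr0 : 0 < r := hr ▸ div_pos (sub_pos.2 hαR.2) hαR.1
    rw [circuitMatrix_eq hαF.1.ne' hαR.1.ne' hf hr] at h1 h2 hdet
    rw [principalColumns_mulVec] at h1 h2
    rw [Matrix.det_fin_four_expansion] at hdet
    simp [principalColumns] at hdet
    simp [Matrix.mulVec, dotProduct] at h1 h2
    have hM22 : 0 < (1 + f) * G0b + f * (G2b + G1) := by positivity
    -- Writing `m i j` for the matrix entries, `m 0 0 - m 1 0 = f * G0a + (f + r) * (G2a + G2) > 0`,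
    -- and the nonpositive minor says `m 0 0 * m 2 2 ≤ G1 * G2`. Hence `m 1 0 * m 2 2 < G1 * G2 < (1
    -- + r) * G1 * G2`.
    have hlt : (G0a - r * (G2a + G2)) * ((1 + f) * G0b + f * (G2b + G1)) < (1 + r) * G1 * G2 := by
      have hP : 0 < f * G0a + (f + r) * (G2a + G2) := by positivity
      have h3 := mul_pos hP hM22
      have h4 : 0 < r * (G1 * G2) := by positivity
      nlinarith
    refine neg_of_mul_neg_left (a := v 1) ?_ hM22.le
    have h3 : v 1 * ((1 + f) * G0b + f * (G2b + G1)) =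
        (G0a - r * (G2a + G2)) * ((1 + f) * G0b + f * (G2b + G1)) - (1 + r) * G1 * G2 := by
      linear_combination ((1 + f) * G0b + f * (G2b + G1)) * h1 + (1 + r) * G1 * h2
    linarith

theorem existsUnique_isLCPSolution_circuitMatrix {G0a G1a G2a G0b G1b G2b G1 G2 αF αR : ℝ}
    (hG0a : 0 < G0a) (hG1a : 0 < G1a) (hG2a : 0 < G2a)
    (hG0b : 0 < G0b) (hG1b : 0 < G1b) (hG2b : 0 < G2b) (hG1 : 0 < G1) (hG2 : 0 < G2)
    (hαF : αF ∈ Ioo (0 : ℝ) 1) (hαR : αR ∈ Ioo (0 : ℝ) 1)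
    (hγ : 0 < circuitGamma G0a G2a G0b G2b G1 G2 αF) :
    (∀ α, 0 < (principalColumns (circuitMatrix G0a G1a G2a G0b G1b G2b G1 G2 αF αR) α).det) ∧
      ∀ q, ∃! z, IsLCPSolution (circuitMatrix G0a G1a G2a G0b G1b G2b G1 G2 αF αR) q z := by
  have hdet : ∀ α,
      0 < (principalColumns (circuitMatrix G0a G1a G2a G0b G1b G2b G1 G2 αF αR) α).det := by
    intro α
    by_cases hα : α = {0, 2}
    · rw [← det_principalColumns_circuitMatrix (G1a := G1a) (G1b := G1b) (αR := αR)
        hαF.1.ne'] at hγ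
      rw [hα]
      exact pos_of_mul_pos_right hγ (sq_nonneg _)
    · exact det_principalColumns_circuitMatrix_pos hG0a hG1a hG2a hG0b hG1b hG2b hG1 hG2 hαF hαR hα
  refine ⟨hdet, ?_⟩
  simp only [isLCPSolution_iff_partialLCP]
  exact existsUnique_partialLCP Finset.univ fun α _ => hdet α

theorem continuous_circuitMatrix_add (G0a G1a G2a G0b G1b G2b G1 G2 αF αR : ℝ) :
    Continuous fun ε : ℝ => circuitMatrix (G0a + ε) G1a G2a G0b G1b G2b G1 G2 αF αR := by
  refine continuous_matrix fun i j => ?_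
  fin_cases i <;> fin_cases j <;> simp [circuitMatrix] <;> fun_prop

/-- `γ` is affine in `G0a` with positive slope, so raising this conductance leaves the degenerate
case towards unique solvability. -/
theorem circuitGamma_add_pos {G0a G2a G0b G2b G1 G2 αF ε : ℝ}
    (hG0b : 0 < G0b) (hG2b : 0 < G2b) (hG1 : 0 < G1) (hαF : αF < 1)
    (hγ : circuitGamma G0a G2a G0b G2b G1 G2 αF = 0) (hε : 0 < ε) :
    0 < circuitGamma (G0a + ε) G2a G0b G2b G1 G2 αF := by
  have h : circuitGamma (G0a + ε) G2a G0b G2b G1 G2 αF =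
      circuitGamma G0a G2a G0b G2b G1 G2 αF + ε * (G0b + (1 - αF) * (G2b + G1)) := by
    simp only [circuitGamma]
    ring
  have hF : 0 < 1 - αF := sub_pos.2 hαF
  rw [h, hγ, zero_add]
  positivity

end LinearComplementarity

theorem mainTheorem8 (G0a G1a G2a G0b G1b G2b G1 G2 αF αR : ℝ)
    (hG0a : 0 < G0a) (hG1a : 0 < G1a) (hG2a : 0 < G2a)
    (hG0b : 0 < G0b) (hG1b : 0 < G1b) (hG2b : 0 < G2b)
    (hG1 : 0 < G1) (hG2 : 0 < G2)
    (hαF : αF ∈ Set.Ioo (0 : ℝ) 1) (hαR : αR ∈ Set.Ioo (0 : ℝ) 1) :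
    (0 < circuitGamma G0a G2a G0b G2b G1 G2 αF →
      ∀ q : Fin 4 → ℝ, ∃! z : Fin 4 → ℝ,
        IsLCPSolution (circuitMatrix G0a G1a G2a G0b G1b G2b G1 G2 αF αR) q z) ∧
    (circuitGamma G0a G2a G0b G2b G1 G2 αF < 0 →
      -- the index set `{1, 3}` of the mathematical text is `{0, 2}` in `Fin 4`
      (interior (complementaryCone
        (circuitMatrix G0a G1a G2a G0b G1b G2b G1 G2 αF αR) {0, 2})).Nonempty ∧
      ((complementaryCone
        (circuitMatrix G0a G1a G2a G0b G1b G2b G1 G2 αF αR) {0, 2})ᶜ).Nonempty ∧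
      (∀ q ∈ interior (complementaryCone
          (circuitMatrix G0a G1a G2a G0b G1b G2b G1 G2 αF αR) {0, 2}),
        {z : Fin 4 → ℝ |
          IsLCPSolution (circuitMatrix G0a G1a G2a G0b G1b G2b G1 G2 αF αR) q z}.ncard = 3) ∧
      (∀ q : Fin 4 → ℝ,
        q ∉ complementaryCone (circuitMatrix G0a G1a G2a G0b G1b G2b G1 G2 αF αR) {0, 2} →
        ∃! z : Fin 4 → ℝ,
          IsLCPSolution (circuitMatrix G0a G1a G2a G0b G1b G2b G1 G2 αF αR) q z)) ∧
    (circuitGamma G0a G2a G0b G2b G1 G2 αF = 0 →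
      ¬ LCPStable (circuitMatrix G0a G1a G2a G0b G1b G2b G1 G2 αF αR)) := by
  refine ⟨fun hγ => (existsUnique_isLCPSolution_circuitMatrix hG0a hG1a hG2a hG0b hG1b hG2b hG1 hG2
    hαF hαR hγ).2, fun hγ => ?_, fun hγ hstable => ?_⟩
  · have hM := isAlmostP_circuitMatrix hG0a hG1a hG2a hG0b hG1b hG2b hG1 hG2 hαF hαR hγ.le
    have hneg : (principalColumns
        (circuitMatrix G0a G1a G2a G0b G1b G2b G1 G2 αF αR) {0, 2}).det < 0 := by
      rw [← det_principalColumns_circuitMatrix (G1a := G1a) (G1b := G1b) (αR := αR)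
        hαF.1.ne'] at hγ
      exact neg_of_mul_neg_right hγ (sq_nonneg _)
    exact ⟨nonempty_interior_complementaryCone hneg.ne, nonempty_compl_complementaryCone hneg.ne,
      fun q hq => hM.ncard_eq_three hneg hq, fun q hq => hM.existsUnique_of_notMem hq⟩
  · have hM := isAlmostP_circuitMatrix hG0a hG1a hG2a hG0b hG1b hG2b hG1 hG2 hαF hαR hγ.le
    have h0 : (principalColumns
        (circuitMatrix G0a G1a G2a G0b G1b G2b G1 G2 αF αR) {0, 2}).det = 0 := by
      rw [← det_principalColumns_circuitMatrix (G1a := G1a) (G1b := G1b) (αR := αR)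
        hαF.1.ne'] at hγ
      exact (mul_eq_zero.1 hγ).resolve_left (pow_ne_zero 2 hαF.1.ne')
    obtain ⟨U, hU, hequiv⟩ := hstable
    have hnear : ∀ᶠ ε in nhdsWithin (0 : ℝ) (Set.Ioi 0),
        circuitMatrix (G0a + ε) G1a G2a G0b G1b G2b G1 G2 αF αR ∈ U :=
      ((continuous_circuitMatrix_add G0a G1a G2a G0b G1b G2b G1 G2 αF αR).continuousAt.eventually_mem
        (by simpa using hU)).filter_mono nhdsWithin_le_nhds
    obtain ⟨ε, hεU, hε⟩ := (hnear.and self_mem_nhdsWithin).exists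
    have hε : 0 < ε := hε
    obtain ⟨hdetN, huniqN⟩ := existsUnique_isLCPSolution_circuitMatrix (G1a := G1a) (G1b := G1b)
      (add_pos hG0a hε) hG1a hG2a hG0b hG1b hG2b hG1 hG2 hαF hαR
      (circuitGamma_add_pos hG0b hG2b hG1 hαF.2 hγ hε)
    exact not_lcpEquivalent h0 (fun q hq => hM.existsUnique_of_notMem hq)
      (fun α => (hdetN α).ne') huniqN (hequiv _ hεU)
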